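/- \textbf{Setting.} A \emph{polarisation-preserving circuit} on $n$ modes (wires $0,\dots,n-1$ from top to bottom) is a morphism $n\to n$ of the free PRO (strict monoidal category with monoid of objects $\mathbb N$, composition $\circ$, tensor $\oplus$ written top to bottom) generated by phase shifters $P(\varphi):1\to1$ and beam splitters $B(\theta):2\to2$, $\varphi,\theta\in\mathbb R$; so circuits are taken up to deformation. Write $I_k$ for $k$ parallel wires. The semantics $[\![C]\!]:\mathbb C^n\to\mathbb C^n$ is the functor sending $\circ$ to composition, $\oplus$ to direct sum, with $$[\![P(\varphi)]\!]=(e^{i\varphi}),\qquad [\![B(\theta)]\!]=\begin{pmatrix}\cos\theta&i\sin\theta\\ i\sin\theta&\cos\theta\end{pmatrix}.$$ The rewrite system PPRS applies, anywhere inside a circuit, the following rules, where $\psi\in\mathbb R\setminus[0,2\pi)$, $\varphi,\varphi_1,\varphi_2\in(0,2\pi)$, $\varphi_0,\theta_4\in[\pi,2\pi)$, $\theta,\theta_0,\theta_1,\theta_2,\theta_3\in(0,\pi)$, $\theta_0\ne\frac\pi2$, and $P^*(\varphi_i)$ stands for either $P(\varphi_i)$ or $I_1$: \begin{enumerate} \item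 $P(\psi)\to P(\psi\bmod 2\pi)$, and $B(\psi)\to B(\psi\bmod 2\pi)$; \item $P(\varphi_2)\circ P(\varphi_1)\to P(\varphi_1+\varphi_2)$; $\;P(0)\to I_1$; $\;B(0)\to I_2$; \item $B(\theta)\circ(I_1\oplus P(\varphi))\to(P(\varphi)\oplus P(\varphi))\circ B(\theta)\circ(P(-\varphi)\oplus I_1)$; \item $B(\frac\pi2)\circ(P(\varphi)\oplus I_1)\to(I_1\oplus P(\varphi))\circ B(\frac\pi2)$; \item $B(\theta_0)\circ(P(\varphi_0)\oplus I_1)\to(I_1\oplus P(\pi))\circ B(\pi-\theta_0)\circ(P(\varphi_0-\pi)\oplus I_1)$; \item $B(\theta_4)\to(P(\pi)\oplus P(\pi))\circ B(\theta_4-\pi)$; \item $(B(\theta_3)\oplus I_1)\circ(I_1\oplus B(\theta_2))\circ(P^*(\varphi_2)\oplus P^*(\varphi_1)\oplus I_1)\circ(B(\theta_1)\oplus I_1)\to (P(\beta_4)\oplus P(\beta_5)\oplus P(\beta_6))\circ(I_1\oplus A_3)\circ(A_2\oplus I_1)\circ(I_1\oplus A_1)$ with $A_i=B(\alpha_i)\circ(P(\beta_i)\oplus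 I_1)$, where the angles on the right are the unique ones that give both sides the same semantics and satisfy $\alpha_i,\beta_i\in[0,\pi)$ for $i\le3$, $\beta_4,\beta_5,\beta_6\in[0,2\pi)$, $\alpha_i\in\{0,\frac\pi2\}\Rightarrow\beta_i=0$, $\alpha_2=0\Rightarrow\alpha_1=0$; \item $B(\theta_2)\circ(P^*(\varphi_1)\oplus I_1)\circ B(\theta_1)\to(P(\beta_2)\oplus P(\beta_3))\circ B(\alpha_1)\circ(P(\beta_1)\oplus I_1)$, where the angles on the right are the unique ones that give both sides the same semantics and satisfy $\alpha_1,\beta_1\in[0,\pi)$, $\beta_2,\beta_3\in[0,2\pi)$, $\alpha_1\in\{0,\frac\pi2\}\Rightarrow\beta_1=0$. \end{enumerate} A \emph{normal form} of $C$ is a circuit $N$ that is obtained from $C$ by finitely many rewrite steps and to which no rule applies. A \emph{PPRS triangular normal form} is a circuit $T_0$ on $n$ modes of the following form, where $T_i$ acts on the modes $i,\dots,n-1$, $T_n$ is the empty circuit, and $$T_i=(I_1\oplus T_{i+1})\circ P^i(\gamma_i)\circ A^{i}(\alpha_{i,0},\beta_{i,0})\circ A^{i+1}(\alpha_{i,1},\beta_{i,1})\circ\cdots\circ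 A^{n-2}(\alpha_{i,n-2-i},\beta_{i,n-2-i}).$$ Here $P^k(\gamma)$ is a phase shifter on mode $k$, $A^k(\alpha,\beta)$ is a phase shifter $P(\beta)$ on mode $k$ followed by a beam splitter $B(\alpha)$ on modes $k,k+1$, every $0$-angled phase shifter or beam splitter is replaced by the identity, and $\alpha_{i,j},\beta_{i,j}\in[0,\pi)$, $\gamma_i\in[0,2\pi)$, $\alpha_{i,j}=0\Rightarrow\alpha_{i,j'}=0$ for all $j'>j$, and $\alpha_{i,j}\in\{0,\frac\pi2\}\Rightarrow\beta_{i,j}=0$. \textbf{Theorem.} Let $C_1,C_2$ be polarisation-preserving circuits on $n\ge 0$ modes with $[\![C_1]\!]=[\![C_2]\!]$. Then each $C_i$ has exactly one PPRS normal form $N_i$, it is a PPRS triangular normal form, and $N_1=N_2$. Hence PPRS is complete for polarisation-preserving circuits: $C_1$ and $C_2$ can be transformed into each other by applying the rules of PPRS as equations (in either direction). -/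

import Mathlib

open Real

noncomputable section

/-- Formal expressions for polarisation-preserving circuits `n → n`: identities, a phase shifter,
a beam splitter, sequential composition (`comp D₂ D₁` is `D₂ ∘ D₁`, so `D₁` acts first) and
parallel composition (`tensor D₁ D₂` puts `D₁` on top of `D₂`; the topmost mode has index `0`).
All generators have as many inputs as outputs, so there are no circuits `n → m` with `n ≠ m`. -/
inductive PPTerm : ℕ → Type
  | id (n : ℕ) : PPTerm n
  | phase (φ : ℝ) : PPTerm 1
  | bs (θ : ℝ) : PPTerm 2
  | comp {n : ℕ} (D₂ D₁ : PPTerm n) : PPTerm n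
  | tensor {n m : ℕ} (D₁ : PPTerm n) (D₂ : PPTerm m) : PPTerm (n + m)

/-- Transport of an expression along an equality of numbers of modes. -/
def PPTerm.cast {n m : ℕ} (h : n = m) (D : PPTerm n) : PPTerm m := h ▸ D

/-- Equality of expressions up to deformation: the smallest congruence that satisfies the axioms of
strict monoidal categories. -/
inductive PROEq : ∀ {n : ℕ}, PPTerm n → PPTerm n → Prop
  | refl {n : ℕ} (D : PPTerm n) : PROEq D D
  | symm {n : ℕ} {D E : PPTerm n} : PROEq D E → PROEq E D
  | trans {n : ℕ} {D E F : PPTerm n} : PROEq D E → PROEq E F → PROEq D F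
  | comp_congr {n : ℕ} {D D' E E' : PPTerm n} :
      PROEq D D' → PROEq E E' → PROEq (.comp D E) (.comp D' E')
  | tensor_congr {n m : ℕ} {D D' : PPTerm n} {E E' : PPTerm m} :
      PROEq D D' → PROEq E E' → PROEq (.tensor D E) (.tensor D' E')
  | id_comp {n : ℕ} (D : PPTerm n) : PROEq (.comp (.id n) D) D
  | comp_id {n : ℕ} (D : PPTerm n) : PROEq (.comp D (.id n)) D
  | comp_assoc {n : ℕ} (D E F : PPTerm n) :
      PROEq (.comp (.comp D E) F) (.comp D (.comp E F))
  | tensor_id (n m : ℕ) : PROEq (.tensor (.id n) (.id m)) (.id (n + m))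
  | interchange {n m : ℕ} (D₂ D₁ : PPTerm n) (E₂ E₁ : PPTerm m) :
      PROEq (.tensor (.comp D₂ D₁) (.comp E₂ E₁)) (.comp (.tensor D₂ E₂) (.tensor D₁ E₁))
  | tensor_empty {n : ℕ} (D : PPTerm n) : PROEq (.tensor D (.id 0)) D
  | empty_tensor {n : ℕ} (D : PPTerm n) :
      PROEq ((PPTerm.tensor (.id 0) D).cast (Nat.zero_add n)) D
  | tensor_assoc {n m k : ℕ} (D : PPTerm n) (E : PPTerm m) (F : PPTerm k) :
      PROEq ((PPTerm.tensor (.tensor D E) F).cast (Nat.add_assoc n m k))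
        (.tensor D (.tensor E F))

instance PPTerm.setoid (n : ℕ) : Setoid (PPTerm n) where
  r := PROEq
  iseqv := ⟨PROEq.refl, PROEq.symm, PROEq.trans⟩

/-- Polarisation-preserving circuits on `n` modes: the morphisms `n → n` of the free PRO generated
by the phase shifters `1 → 1` and the beam splitters `2 → 2`. -/
def PPCircuit (n : ℕ) : Type := Quotient (PPTerm.setoid n)

namespace PPCircuit

/-- The identity circuit on `n` modes. -/
def wires (n : ℕ) : PPCircuit n := Quotient.mk _ (.id n)

/-- The phase shifter with phase `φ`. -/
def phase (φ : ℝ) : PPCircuit 1 := Quotient.mk _ (.phase φ)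

/-- The beam splitter with angle `θ`. -/
def bs (θ : ℝ) : PPCircuit 2 := Quotient.mk _ (.bs θ)

/-- Sequential composition; the right argument acts first. -/
def comp {n : ℕ} (D₂ D₁ : PPCircuit n) : PPCircuit n :=
  Quotient.map₂ PPTerm.comp (fun _ _ h _ _ h' => PROEq.comp_congr h h') D₂ D₁

/-- Parallel composition; the left argument is on top. -/
def tensor {n m : ℕ} (D₁ : PPCircuit n) (D₂ : PPCircuit m) : PPCircuit (n + m) :=
  Quotient.map₂ PPTerm.tensor (fun _ _ h _ _ h' => PROEq.tensor_congr h h') D₁ D₂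

/-- Transport of a circuit along an equality of numbers of modes. -/
def cast {n m : ℕ} (h : n = m) (D : PPCircuit n) : PPCircuit m := h ▸ D

end PPCircuit

infixr:80 " ∘ₚ " => PPCircuit.comp
infixl:85 " ⊕ₚ " => PPCircuit.tensor

/-! ### Semantics -/

/-- The direct sum of two square matrices. -/
def directSum {n m : ℕ} (A : Matrix (Fin n) (Fin n) ℂ) (B : Matrix (Fin m) (Fin m) ℂ) :
    Matrix (Fin (n + m)) (Fin (n + m)) ℂ :=
  Matrix.reindex finSumFinEquiv finSumFinEquiv (Matrix.fromBlocks A 0 0 B)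

/-- The semantics of an expression, as the matrix of a linear map `ℂⁿ → ℂⁿ`. -/
def PPTerm.interpH : {n : ℕ} → PPTerm n → Matrix (Fin n) (Fin n) ℂ
  | _, .id _ => 1
  | _, .phase φ => !![Complex.exp (Complex.I * φ)]
  | _, .bs θ =>
      !![Complex.cos θ, Complex.I * Complex.sin θ; Complex.I * Complex.sin θ, Complex.cos θ]
  | _, .comp D₂ D₁ => D₂.interpH * D₁.interpH
  | _, .tensor D₁ D₂ => directSum D₁.interpH D₂.interpH

/-- Polarisations: vertical and horizontal. -/
inductive Pol : Type
  | V
  | H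

instance : DecidableEq Pol := fun a b => by
  cases a <;> cases b <;> first | exact isTrue rfl | exact isFalse (by intro h; cases h)

instance : Fintype Pol := ⟨{Pol.V, Pol.H}, fun x => by cases x <;> simp⟩

/-- The single-photon semantics on `ℂ^{Mₙ}` with `Mₙ = {V, H} × [n]`, as a matrix. -/
def PPTerm.interp : {n : ℕ} → PPTerm n → Matrix (Pol × Fin n) (Pol × Fin n) ℂ
  | _, .id _ => 1
  | _, .phase φ => Matrix.of fun x y => if x = y then Complex.exp (Complex.I * φ) else 0
  | _, .bs θ => Matrix.of fun x y =>
      if x = y then Complex.cos θ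
      else if x = (y.1, 1 - y.2) then Complex.I * Complex.sin θ else 0
  | _, .comp D₂ D₁ => D₂.interp * D₁.interp
  | _, .tensor D₁ D₂ => Matrix.of fun x y =>
      match finSumFinEquiv.symm x.2, finSumFinEquiv.symm y.2 with
      | .inl i, .inl j => D₁.interp (x.1, i) (y.1, j)
      | .inr i, .inr j => D₂.interp (x.1, i) (y.1, j)
      | _, _ => 0

/-- The matrix of `ι : ℂⁿ → ℂ^{Mₙ}`, `|k⟩ ↦ |H_k⟩`. -/
def iotaH (n : ℕ) : Matrix (Pol × Fin n) (Fin n) ℂ :=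
  Matrix.of fun x k => if x = (Pol.H, k) then 1 else 0

theorem PPTerm.interp_apply {n : ℕ} (D : PPTerm n) (c : Pol) (k : Fin n) (x : Pol × Fin n) :
    D.interp x (c, k) = if x.1 = c then D.interpH x.2 k else 0 := by
  induction D generalizing c with
  | id n =>
    simp only [PPTerm.interp, PPTerm.interpH, Matrix.one_apply, Prod.ext_iff]
    split_ifs <;> simp_all
  | phase φ =>
    obtain ⟨d, i⟩ := x
    obtain rfl := Subsingleton.elim i k
    fin_cases i
    simp [PPTerm.interp, PPTerm.interpH]
  | bs θ =>
    obtain ⟨d, i⟩ := x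
    fin_cases i <;> fin_cases k <;> simp [PPTerm.interp, PPTerm.interpH]
  | comp D₂ D₁ ih₂ ih₁ =>
    simp only [PPTerm.interp, PPTerm.interpH, Matrix.mul_apply, Fintype.sum_prod_type, ih₁, ih₂]
    rw [Finset.sum_eq_single c]
    · simp only [if_true]
      split_ifs <;> simp
    · intro b _ hb
      simp [hb]
    · simp
  | tensor D₁ D₂ ih₁ ih₂ =>
    obtain ⟨d, i⟩ := x
    obtain ⟨i, rfl⟩ := finSumFinEquiv.surjective i
    obtain ⟨k, rfl⟩ := finSumFinEquiv.surjective k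
    rcases i with i | i <;> rcases k with k | k <;>
      simp [PPTerm.interp, PPTerm.interpH, directSum, ih₁, ih₂, -finSumFinEquiv_apply_left,
        -finSumFinEquiv_apply_right]

/-- `⟦D⟧ ∘ ι = ι ∘ ⟦D⟧_H`, which determines `⟦D⟧_H` because `ι` is injective. -/
theorem PPTerm.interp_mul_iotaH {n : ℕ} (D : PPTerm n) :
    D.interp * iotaH n = iotaH n * D.interpH := by
  ext x k
  obtain ⟨d, i⟩ := x
  simp only [Matrix.mul_apply, iotaH, Matrix.of_apply, mul_ite, mul_one, mul_zero,
    Finset.sum_ite_eq', Finset.mem_univ, if_true, D.interp_apply, Prod.mk.injEq]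
  by_cases hd : d = Pol.H <;> simp [hd]

theorem PPTerm.interpH_cast {n m : ℕ} (h : n = m) (D : PPTerm n) :
    (D.cast h).interpH = Matrix.reindex (finCongr h) (finCongr h) D.interpH := by
  subst h
  rfl

theorem PROEq.interpH_eq {n : ℕ} {D E : PPTerm n} (h : PROEq D E) : D.interpH = E.interpH := by
  induction h with
  | refl D => rfl
  | symm _ ih => exact ih.symm
  | trans _ _ ih₁ ih₂ => exact ih₁.trans ih₂
  | comp_congr _ _ ih₁ ih₂ => simp only [PPTerm.interpH, ih₁, ih₂]
  | tensor_congr _ _ ih₁ ih₂ => simp only [PPTerm.interpH, ih₁, ih₂]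
  | id_comp D => simp [PPTerm.interpH]
  | comp_id D => simp [PPTerm.interpH]
  | comp_assoc D E F => simp [PPTerm.interpH, Matrix.mul_assoc]
  | tensor_id n m => simp [PPTerm.interpH, directSum]
  | interchange D₂ D₁ E₂ E₁ =>
    simp [PPTerm.interpH, directSum, Matrix.fromBlocks_multiply, Matrix.submatrix_mul_equiv]
  | tensor_empty D =>
    ext i j
    obtain ⟨i, rfl⟩ := finSumFinEquiv.surjective i
    obtain ⟨j, rfl⟩ := finSumFinEquiv.surjective j
    rcases i with i | i
    · rcases j with j | j
      · simp only [PPTerm.interpH, directSum, Matrix.reindex_apply, Matrix.submatrix_apply,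
          Equiv.symm_apply_apply, Matrix.fromBlocks_apply₁₁]
        rfl
      · exact j.elim0
    · exact i.elim0
  | @empty_tensor n D =>
    rw [PPTerm.interpH_cast]
    ext i j
    have key : ∀ i : Fin n, finSumFinEquiv.symm ((finCongr (Nat.zero_add n)).symm i) =
        (Sum.inr i : Fin 0 ⊕ Fin n) := by
      intro i
      rw [Equiv.symm_apply_eq]
      ext
      simp
    simp only [PPTerm.interpH, directSum, Matrix.reindex_apply, Matrix.submatrix_apply, key,
      Matrix.fromBlocks_apply₂₂]
  | @tensor_assoc n m k D E F =>
    rw [PPTerm.interpH_cast]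
    have h₁ : ∀ i : Fin n, (finCongr (Nat.add_assoc n m k)).symm (finSumFinEquiv (Sum.inl i)) =
        finSumFinEquiv (Sum.inl (finSumFinEquiv (Sum.inl i))) := fun i => by ext; simp
    have h₂ : ∀ i : Fin m, (finCongr (Nat.add_assoc n m k)).symm
        (finSumFinEquiv (Sum.inr (finSumFinEquiv (Sum.inl i)))) =
        finSumFinEquiv (Sum.inl (finSumFinEquiv (Sum.inr i))) := fun i => by ext; simp
    have h₃ : ∀ i : Fin k, (finCongr (Nat.add_assoc n m k)).symm
        (finSumFinEquiv (Sum.inr (finSumFinEquiv (Sum.inr i)))) =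
        finSumFinEquiv (Sum.inr i) := fun i => by ext; simp; omega
    ext i j
    obtain ⟨i, rfl⟩ := finSumFinEquiv.surjective i
    obtain ⟨j, rfl⟩ := finSumFinEquiv.surjective j
    rcases i with i | i
    · rcases j with j | j
      · simp only [PPTerm.interpH, directSum, Matrix.reindex_apply, Matrix.submatrix_apply, h₁,
          Equiv.symm_apply_apply, Matrix.fromBlocks_apply₁₁]
      · obtain ⟨j, rfl⟩ := finSumFinEquiv.surjective j
        rcases j with j | j <;>
        simp only [PPTerm.interpH, directSum, Matrix.reindex_apply, Matrix.submatrix_apply, h₁, h₂,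
          h₃, Equiv.symm_apply_apply, Matrix.fromBlocks_apply₁₁, Matrix.fromBlocks_apply₁₂,
          Matrix.zero_apply]
    · obtain ⟨i, rfl⟩ := finSumFinEquiv.surjective i
      rcases j with j | j
      · rcases i with i | i <;>
        simp only [PPTerm.interpH, directSum, Matrix.reindex_apply, Matrix.submatrix_apply, h₁, h₂,
          h₃, Equiv.symm_apply_apply, Matrix.fromBlocks_apply₁₁, Matrix.fromBlocks_apply₂₁,
          Matrix.zero_apply]
      · obtain ⟨j, rfl⟩ := finSumFinEquiv.surjective j
        rcases i with i | i <;> rcases j with j | j <;>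
        simp only [PPTerm.interpH, directSum, Matrix.reindex_apply, Matrix.submatrix_apply, h₂,
          h₃, Equiv.symm_apply_apply, Matrix.fromBlocks_apply₁₁, Matrix.fromBlocks_apply₂₁,
          Matrix.fromBlocks_apply₁₂, Matrix.fromBlocks_apply₂₂, Matrix.zero_apply]

/-- The semantics `⟦D⟧_H : ℂⁿ → ℂⁿ` of a circuit, as a matrix. -/
def PPCircuit.interpH {n : ℕ} (D : PPCircuit n) : Matrix (Fin n) (Fin n) ℂ :=
  Quotient.lift PPTerm.interpH (fun _ _ h => PROEq.interpH_eq h) D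

/-! ### The rewrite system PPRS -/

/-- A starred phase shifter in a rule: a phase shifter (`some φ`) or a plain wire (`none`). -/
def phaseOpt : Option ℝ → PPCircuit 1
  | none => PPCircuit.wires 1
  | some φ => PPCircuit.phase φ

open PPCircuit in
/-- Three parallel one-mode circuits, from top to bottom. -/
def parallel3 (D₀ D₁ D₂ : PPCircuit 1) : PPCircuit 3 := D₀ ⊕ₚ D₁ ⊕ₚ D₂

open PPCircuit in
/-- A two-mode circuit on the top two of three modes. -/
def onTop (D : PPCircuit 2) : PPCircuit 3 := tensor (n := 2) (m := 1) D (wires 1)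

open PPCircuit in
/-- A two-mode circuit on the bottom two of three modes. -/
def onBottom (D : PPCircuit 2) : PPCircuit 3 := tensor (n := 1) (m := 2) (wires 1) D

open PPCircuit in
/-- The rules of PPRS. In `slide` and `euler` the right-hand side is the triangular
circuit, on three and on two modes respectively, that has the semantics of the left-hand side and
satisfies the listed conditions on the angles, which determine it uniquely. -/
inductive PPRSRule : ∀ {n : ℕ}, PPCircuit n → PPCircuit n → Prop
  | phaseMod (ψ : ℝ) (hψ : ψ ∉ Set.Ico 0 (2 * π)) :
      PPRSRule (phase ψ) (phase (toIcoMod two_pi_pos 0 ψ))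
  | bsMod (ψ : ℝ) (hψ : ψ ∉ Set.Ico 0 (2 * π)) :
      PPRSRule (bs ψ) (bs (toIcoMod two_pi_pos 0 ψ))
  | phaseFusion (φ₁ φ₂ : ℝ) (h₁ : φ₁ ∈ Set.Ioo 0 (2 * π)) (h₂ : φ₂ ∈ Set.Ioo 0 (2 * π)) :
      PPRSRule (phase φ₂ ∘ₚ phase φ₁) (phase (φ₁ + φ₂))
  | phaseZero : PPRSRule (phase 0) (wires 1)
  | bsZero : PPRSRule (bs 0) (wires 2)
  | bottomPhase (φ θ : ℝ) (hφ : φ ∈ Set.Ioo 0 (2 * π)) (hθ : θ ∈ Set.Ioo 0 π) :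
      PPRSRule (bs θ ∘ₚ (wires 1 ⊕ₚ phase φ))
        ((phase φ ⊕ₚ phase φ) ∘ₚ bs θ ∘ₚ (phase (-φ) ⊕ₚ wires 1))
  | topPhaseHalfPi (φ : ℝ) (hφ : φ ∈ Set.Ioo 0 (2 * π)) :
      PPRSRule (bs (π / 2) ∘ₚ (phase φ ⊕ₚ wires 1)) ((wires 1 ⊕ₚ phase φ) ∘ₚ bs (π / 2))
  | topPhasePi (φ₀ θ₀ : ℝ) (hφ : φ₀ ∈ Set.Ico π (2 * π)) (hθ : θ₀ ∈ Set.Ioo 0 π)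
      (hθ' : θ₀ ≠ π / 2) :
      PPRSRule (bs θ₀ ∘ₚ (phase φ₀ ⊕ₚ wires 1))
        ((wires 1 ⊕ₚ phase π) ∘ₚ bs (π - θ₀) ∘ₚ (phase (φ₀ - π) ⊕ₚ wires 1))
  | bsSubPi (θ₄ : ℝ) (hθ : θ₄ ∈ Set.Ico π (2 * π)) :
      PPRSRule (bs θ₄) ((phase π ⊕ₚ phase π) ∘ₚ bs (θ₄ - π))
  | slide (θ₁ θ₂ θ₃ : ℝ) (φ₁ φ₂ : Option ℝ) (α₁ α₂ α₃ β₁ β₂ β₃ β₄ β₅ β₆ : ℝ)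
      (hθ₁ : θ₁ ∈ Set.Ioo 0 π) (hθ₂ : θ₂ ∈ Set.Ioo 0 π) (hθ₃ : θ₃ ∈ Set.Ioo 0 π)
      (hφ₁ : ∀ φ ∈ φ₁, φ ∈ Set.Ioo 0 (2 * π)) (hφ₂ : ∀ φ ∈ φ₂, φ ∈ Set.Ioo 0 (2 * π))
      (hα₁ : α₁ ∈ Set.Ico 0 π) (hα₂ : α₂ ∈ Set.Ico 0 π) (hα₃ : α₃ ∈ Set.Ico 0 π)
      (hβ₁ : β₁ ∈ Set.Ico 0 π) (hβ₂ : β₂ ∈ Set.Ico 0 π) (hβ₃ : β₃ ∈ Set.Ico 0 π)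
      (hβ₄ : β₄ ∈ Set.Ico 0 (2 * π)) (hβ₅ : β₅ ∈ Set.Ico 0 (2 * π))
      (hβ₆ : β₆ ∈ Set.Ico 0 (2 * π))
      (h₁ : α₁ = 0 ∨ α₁ = π / 2 → β₁ = 0) (h₂ : α₂ = 0 ∨ α₂ = π / 2 → β₂ = 0)
      (h₃ : α₃ = 0 ∨ α₃ = π / 2 → β₃ = 0) (h₂₁ : α₂ = 0 → α₁ = 0)
      (L R : PPCircuit 3)
      (hL : L = onTop (bs θ₃) ∘ₚ onBottom (bs θ₂) ∘ₚ
        parallel3 (phaseOpt φ₂) (phaseOpt φ₁) (wires 1) ∘ₚ onTop (bs θ₁))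
      (hR : R = parallel3 (phase β₄) (phase β₅) (phase β₆) ∘ₚ
        onBottom (bs α₃ ∘ₚ (phase β₃ ⊕ₚ wires 1)) ∘ₚ
        onTop (bs α₂ ∘ₚ (phase β₂ ⊕ₚ wires 1)) ∘ₚ
        onBottom (bs α₁ ∘ₚ (phase β₁ ⊕ₚ wires 1)))
      (hLR : R.interpH = L.interpH) : PPRSRule L R
  | euler (θ₁ θ₂ : ℝ) (φ₁ : Option ℝ) (α₁ β₁ β₂ β₃ : ℝ)
      (hθ₁ : θ₁ ∈ Set.Ioo 0 π) (hθ₂ : θ₂ ∈ Set.Ioo 0 π)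
      (hφ₁ : ∀ φ ∈ φ₁, φ ∈ Set.Ioo 0 (2 * π))
      (hα₁ : α₁ ∈ Set.Ico 0 π) (hβ₁ : β₁ ∈ Set.Ico 0 π)
      (hβ₂ : β₂ ∈ Set.Ico 0 (2 * π)) (hβ₃ : β₃ ∈ Set.Ico 0 (2 * π))
      (h₁ : α₁ = 0 ∨ α₁ = π / 2 → β₁ = 0)
      (L R : PPCircuit 2)
      (hL : L = bs θ₂ ∘ₚ (phaseOpt φ₁ ⊕ₚ wires 1) ∘ₚ bs θ₁)
      (hR : R = (phase β₂ ⊕ₚ phase β₃) ∘ₚ bs α₁ ∘ₚ (phase β₁ ⊕ₚ wires 1))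
      (hLR : R.interpH = L.interpH) : PPRSRule L R

/-- One rewrite step of PPRS: one application of a rule somewhere inside a circuit. -/
inductive PPRSStep : ∀ {n : ℕ}, PPCircuit n → PPCircuit n → Prop
  | rule {n : ℕ} {L R : PPCircuit n} : PPRSRule L R → PPRSStep L R
  | comp_left {n : ℕ} {D D' : PPCircuit n} (E : PPCircuit n) :
      PPRSStep D D' → PPRSStep (D ∘ₚ E) (D' ∘ₚ E)
  | comp_right {n : ℕ} {D D' : PPCircuit n} (E : PPCircuit n) :
      PPRSStep D D' → PPRSStep (E ∘ₚ D) (E ∘ₚ D')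
  | tensor_left {n m : ℕ} {D D' : PPCircuit n} (E : PPCircuit m) :
      PPRSStep D D' → PPRSStep (D ⊕ₚ E) (D' ⊕ₚ E)
  | tensor_right {n m : ℕ} {D D' : PPCircuit n} (E : PPCircuit m) :
      PPRSStep D D' → PPRSStep (E ⊕ₚ D) (E ⊕ₚ D')

/-- `N` is a normal form of `C`: `C` rewrites to `N` in finitely many steps, and no rule applies
to `N`. -/
def IsPPRSNormalFormOf {n : ℕ} (N C : PPCircuit n) : Prop :=
  Relation.ReflTransGen PPRSStep C N ∧ ∀ D : PPCircuit n, ¬ PPRSStep N D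

/-! ### Triangular normal forms -/

open Classical in
/-- A phase shifter, replaced by a wire if its phase is `0`. -/
def phaseStar (φ : ℝ) : PPCircuit 1 := if φ = 0 then PPCircuit.wires 1 else PPCircuit.phase φ

open Classical in
/-- A beam splitter, replaced by two wires if its angle is `0`. -/
def bsStar (θ : ℝ) : PPCircuit 2 := if θ = 0 then PPCircuit.wires 2 else PPCircuit.bs θ

open PPCircuit in
/-- One diagonal of the triangle: `n` starred beam splitters on `n + 1` modes; the one with angle
`α j` acts on modes `j, j + 1` and has the phase `β j` on its top left. They are traversed from
the bottom (`j = n - 1`) to the top (`j = 0`). -/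
def diagonal : (n : ℕ) → (α β : ℕ → ℝ) → PPCircuit (n + 1)
  | 0, _, _ => wires 1
  | n + 1, α, β =>
      (((bsStar (α 0) ∘ₚ (phaseStar (β 0) ⊕ₚ wires 1)) ⊕ₚ wires n).cast (Nat.add_comm 2 n)) ∘ₚ
        ((wires 1 ⊕ₚ diagonal n (fun j => α (j + 1)) (fun j => β (j + 1))).cast
          (Nat.add_comm 1 (n + 1)))

open PPCircuit in
/-- The triangle on `n` modes: on `n + 1` modes, a diagonal, then the phase `γ 0` on mode `0`, then
a triangle on the remaining `n` modes. -/
def triangle : (n : ℕ) → (α β : ℕ → ℕ → ℝ) → (γ : ℕ → ℝ) → PPCircuit n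
  | 0, _, _, _ => wires 0
  | n + 1, α, β, γ =>
      ((wires 1 ⊕ₚ triangle n (fun i => α (i + 1)) (fun i => β (i + 1)) (fun i => γ (i + 1))).cast
        (Nat.add_comm 1 n)) ∘ₚ
      ((phaseStar (γ 0) ⊕ₚ wires n).cast (Nat.add_comm 1 n)) ∘ₚ
      diagonal n (α 0) (β 0)

/-- Triangular normal forms. (Only the angles `α i j`, `β i j` with `i + j + 1 < n` and `γ i` with
`i < n` occur in the circuit; the others may be taken to be `0`.) -/
def IsTriangularNormalForm {n : ℕ} (T : PPCircuit n) : Prop :=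
  ∃ (α β : ℕ → ℕ → ℝ) (γ : ℕ → ℝ),
    (∀ i j, α i j ∈ Set.Ico 0 π) ∧ (∀ i j, β i j ∈ Set.Ico 0 π) ∧
    (∀ i, γ i ∈ Set.Ico 0 (2 * π)) ∧
    (∀ i j, α i j = 0 → ∀ j', j < j' → α i j' = 0) ∧
    (∀ i j, α i j = 0 ∨ α i j = π / 2 → β i j = 0) ∧
    T = triangle n α β γ

end

/-! No confluence analysis is needed. Four facts suffice: every step preserves the semantics; PPRS
terminates; a circuit to which no rule applies is a triangle; and two triangles with the same matrix
are equal. By termination each circuit has a normal form, and any normal form is a triangle with the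
matrix of the original circuit, hence unique and shared by all circuits with that matrix. Equational
completeness follows by passing through the common normal form.

Termination (`PPRSStep.decreases`) uses a lexicographic measure: the weighted number of beam
splitters, then their total height above the bottom wire, then a weighted sum of the phases in which
each wire segment weighs more the earlier it lies.

Uniqueness (`triangle_unique`) reads the angles off the matrix. Only the phase on mode `0` and the
first diagonal affect the first row, and the row determines their angles; these unitary factors
cancel, leaving a smaller triangle. Run in the opposite direction, the argument makes every unitary
matrix the matrix of a triangle (`exists_triangle`), so the right-hand sides of `slide` and `euler`
always exist and every instance of their left-hand sides is a redex.

Triangularity (`PPRSIrreducible.isTriangularNormalForm`) removes the last gate. What remains is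
irreducible, so a triangle by induction; putting the gate back either extends this triangle or
creates a redex. -/

noncomputable section

/-! ### Circuits on a fixed number of modes as a monoid generated by placed gates. -/

namespace PPCircuit

instance (n : ℕ) : Monoid (PPCircuit n) where
  mul := comp
  one := wires n
  mul_assoc := by
    rintro ⟨D⟩ ⟨E⟩ ⟨F⟩
    exact Quotient.sound (PROEq.comp_assoc D E F)
  one_mul := by
    rintro ⟨D⟩
    exact Quotient.sound (PROEq.id_comp D)
  mul_one := by
    rintro ⟨D⟩
    exact Quotient.sound (PROEq.comp_id D)

theorem comp_eq_mul {n : ℕ} (D E : PPCircuit n) : comp D E = D * E := rfl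

theorem wires_eq_one (n : ℕ) : wires n = 1 := rfl

theorem mk_cast {n m : ℕ} (h : n = m) (D : PPTerm n) :
    (Quotient.mk _ (D.cast h) : PPCircuit m) = cast h (Quotient.mk _ D) := by
  subst h
  rfl

theorem one_tensor_one (n m : ℕ) : tensor (1 : PPCircuit n) (1 : PPCircuit m) = 1 :=
  Quotient.sound (PROEq.tensor_id n m)

theorem mul_tensor_mul {n m : ℕ} (D₂ D₁ : PPCircuit n) (E₂ E₁ : PPCircuit m) :
    tensor (D₂ * D₁) (E₂ * E₁) = tensor D₂ E₂ * tensor D₁ E₁ := by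
  induction D₂ using Quotient.inductionOn
  induction D₁ using Quotient.inductionOn
  induction E₂ using Quotient.inductionOn
  induction E₁ using Quotient.inductionOn
  exact Quotient.sound (PROEq.interchange _ _ _ _)

theorem tensor_empty {n : ℕ} (D : PPCircuit n) : tensor D (1 : PPCircuit 0) = D := by
  induction D using Quotient.inductionOn
  exact Quotient.sound (PROEq.tensor_empty _)

theorem cast_cast {n m k : ℕ} (h : n = m) (h' : m = k) (D : PPCircuit n) :
    cast h' (cast h D) = cast (h.trans h') D := by
  subst h h'
  rfl

theorem cast_rfl {n : ℕ} (h : n = n) (D : PPCircuit n) : cast h D = D := rfl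

theorem cast_one {n m : ℕ} (h : n = m) : cast h (1 : PPCircuit n) = 1 := by
  subst h
  rfl

theorem cast_mul {n m : ℕ} (h : n = m) (D E : PPCircuit n) :
    cast h (D * E) = cast h D * cast h E := by
  subst h
  rfl

theorem cast_tensor {n n' m : ℕ} (h : n = n') (D : PPCircuit n) (E : PPCircuit m) :
    tensor (cast h D) E = cast (congrArg (· + m) h) (tensor D E) := by
  subst h
  rfl

theorem one_zero_tensor {n : ℕ} (D : PPCircuit n) :
    tensor (1 : PPCircuit 0) D = cast (Nat.zero_add n).symm D := by
  induction D using Quotient.inductionOn with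
  | _ D =>
    have h := mk_cast (Nat.zero_add n) (PPTerm.tensor (.id 0) D)
    rw [show (Quotient.mk _ ((PPTerm.tensor (.id 0) D).cast (Nat.zero_add n)) : PPCircuit n)
      = Quotient.mk _ D from Quotient.sound (PROEq.empty_tensor D)] at h
    exact ((congrArg (cast (Nat.zero_add n).symm) h).trans (cast_cast _ _ _)).symm

theorem tensor_assoc {n m k : ℕ} (D : PPCircuit n) (E : PPCircuit m) (F : PPCircuit k) :
    tensor D (tensor E F) = cast (Nat.add_assoc n m k) (tensor (tensor D E) F) := by
  induction D using Quotient.inductionOn with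
  | _ D =>
  induction E using Quotient.inductionOn with
  | _ E =>
  induction F using Quotient.inductionOn with
  | _ F =>
    exact (Quotient.sound (PROEq.tensor_assoc D E F)).symm.trans
      (mk_cast (Nat.add_assoc n m k) (PPTerm.tensor (.tensor D E) F))

/-- The circuit `D` on the modes `p, …, p + m - 1` of `n` modes, with wires on the other modes. -/
def place (n p : ℕ) {m : ℕ} (D : PPCircuit m) : PPCircuit n :=
  if h : p + m ≤ n then
    cast (Nat.add_sub_of_le h) (tensor (tensor (1 : PPCircuit p) D) (1 : PPCircuit (n - (p + m))))
  -- This default value lets `place_one` and `place_mul` hold without a bound on `p + m`.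
  else 1

theorem place_eq {n p m r : ℕ} (h : p + m + r = n) (D : PPCircuit m) :
    place n p D = cast h (tensor (tensor (1 : PPCircuit p) D) (1 : PPCircuit r)) := by
  obtain rfl : r = n - (p + m) := by omega
  exact dif_pos (by omega)

theorem place_one (n p m : ℕ) : place n p (1 : PPCircuit m) = 1 := by
  unfold place
  split_ifs
  · rw [one_tensor_one, one_tensor_one, cast_one]
  · rfl

theorem place_mul (n p : ℕ) {m : ℕ} (D E : PPCircuit m) :
    place n p (D * E) = place n p D * place n p E := by
  unfold place
  split_ifs
  · rw [← cast_mul, ← mul_tensor_mul, ← mul_tensor_mul, one_mul, one_mul]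
  · exact (one_mul _).symm

theorem place_self {n : ℕ} (D : PPCircuit n) : place n 0 D = D := by
  rw [place_eq (r := 0) (by simp), tensor_empty, one_zero_tensor, cast_cast]
  rfl

theorem cast_place {n n' p m : ℕ} (h : n = n') (D : PPCircuit m) :
    cast h (place n p D) = place n' p D := by
  subst h
  rfl

theorem place_place {n p m q k : ℕ} (hp : p + m ≤ n) (hq : q + k ≤ m) (D : PPCircuit k) :
    place n p (place m q D) = place n (p + q) D := by
  obtain ⟨r, rfl⟩ := Nat.exists_eq_add_of_le hp
  obtain ⟨s, rfl⟩ := Nat.exists_eq_add_of_le hq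
  rw [place_eq rfl, place_eq rfl, place_eq (r := s + r) (by omega), cast_rfl, cast_rfl,
    tensor_assoc, tensor_assoc, cast_tensor, cast_tensor, cast_tensor, one_tensor_one,
    ← one_tensor_one s r, tensor_assoc]
  simp only [cast_cast]

theorem tensor_one {n m : ℕ} (D : PPCircuit n) :
    tensor D (1 : PPCircuit m) = place (n + m) 0 D := by
  rw [place_eq (r := m) (by simp), one_zero_tensor, cast_tensor, cast_cast]
  rfl

theorem one_tensor {n m : ℕ} (D : PPCircuit m) :
    tensor (1 : PPCircuit n) D = place (n + m) n D := by
  rw [place_eq (r := 0) (by simp), tensor_empty]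
  rfl

theorem tensor_eq {n m : ℕ} (D : PPCircuit n) (E : PPCircuit m) :
    tensor D E = place (n + m) 0 D * place (n + m) n E := by
  rw [← tensor_one, ← one_tensor, ← mul_tensor_mul, one_mul, mul_one]

theorem tensor_eq' {n m : ℕ} (D : PPCircuit n) (E : PPCircuit m) :
    tensor D E = place (n + m) n E * place (n + m) 0 D := by
  rw [← tensor_one, ← one_tensor, ← mul_tensor_mul, one_mul, mul_one]

theorem place_tensor {n p m k : ℕ} (h : p + (m + k) ≤ n) (D : PPCircuit m) (E : PPCircuit k) :
    place n p (tensor D E) = place n p D * place n (p + m) E := by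
  rw [tensor_eq, place_mul, place_place h (by omega), place_place h (by omega), add_zero]

/-- Cut the modes just below `D`: the two circuits become the factors of one parallel composition,
which the interchange law lets one sequentialise in either order. -/
theorem place_comm {n p m q k : ℕ} (hpq : p + m ≤ q) (hq : q + k ≤ n) (D : PPCircuit m)
    (E : PPCircuit k) : place n p D * place n q E = place n q E * place n p D := by
  obtain ⟨s, rfl⟩ := Nat.exists_eq_add_of_le hpq
  obtain ⟨r, rfl⟩ := Nat.exists_eq_add_of_le hq
  have hD : place (p + m + s + k + r) p D =
      place (p + m + s + k + r) 0 (place (p + m) p D) := by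
    rw [place_place (by omega) (by omega), zero_add]
  have hE : place (p + m + s + k + r) (p + m + s) E =
      place (p + m + s + k + r) (p + m) (place (s + k + r) s E) := by
    rw [place_place (by omega) (by omega)]
  have h := (tensor_eq (place (p + m) p D) (place (s + k + r) s E)).symm.trans (tensor_eq' _ _)
  have h' := congrArg (cast (show p + m + (s + k + r) = p + m + s + k + r by omega)) h
  rwa [cast_mul, cast_mul, cast_place, cast_place, ← hD, ← hE] at h'

/-- The phase shifters and beam splitters on single modes and on pairs of adjacent modes. -/
def gates (n : ℕ) : Set (PPCircuit n) :=
  {G | (∃ p φ, p + 1 ≤ n ∧ G = place n p (phase φ)) ∨ ∃ p θ, p + 2 ≤ n ∧ G = place n p (bs θ)}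

/-- Interchange turns each parallel composition into a product of placed circuits, so a circuit can
be treated as a word in gates and inducted on from its last gate. -/
theorem closure_gates (n : ℕ) : Submonoid.closure (gates n) = ⊤ := by
  -- The position varies because the lower factor of a tensor starts at a shifted mode.
  have key : ∀ {m : ℕ} (D : PPTerm m) (p : ℕ), p + m ≤ n →
      place n p (Quotient.mk _ D) ∈ Submonoid.closure (gates n) := by
    intro m D
    induction D with
    | id m =>
      intro p _
      exact (place_one n p m).symm ▸ one_mem _
    | phase φ => exact fun p h => Submonoid.subset_closure (Or.inl ⟨p, φ, h, rfl⟩)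
    | bs θ => exact fun p h => Submonoid.subset_closure (Or.inr ⟨p, θ, h, rfl⟩)
    | comp D₂ D₁ ih₂ ih₁ =>
      intro p h
      exact (place_mul n p (Quotient.mk _ D₂) (Quotient.mk _ D₁)).symm ▸
        mul_mem (ih₂ p h) (ih₁ p h)
    | tensor D₁ D₂ ih₁ ih₂ =>
      intro p h
      exact (place_tensor h (Quotient.mk _ D₁) (Quotient.mk _ D₂)).symm ▸
        mul_mem (ih₁ p (by omega)) (ih₂ _ (by omega))
  refine eq_top_iff.2 fun C _ => ?_
  induction C using Quotient.inductionOn with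
  | _ D =>
    exact place_self (Quotient.mk _ D : PPCircuit n) ▸ key D 0 (by omega)

end PPCircuit

/-! ### Irreducibility and its inheritance by subcircuits. -/

open PPCircuit

/-- No rule of PPRS applies to the circuit. -/
def PPRSIrreducible {n : ℕ} (C : PPCircuit n) : Prop := ∀ D, ¬ PPRSStep C D

theorem PPRSStep.cast {n m : ℕ} (h : n = m) {D D' : PPCircuit n} (hD : PPRSStep D D') :
    PPRSStep (D.cast h) (D'.cast h) := by
  subst h
  exact hD

theorem PPRSStep.place {n p m : ℕ} (h : p + m ≤ n) {D D' : PPCircuit m} (hD : PPRSStep D D') :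
    PPRSStep (place n p D) (place n p D') := by
  obtain ⟨r, rfl⟩ := Nat.exists_eq_add_of_le h
  rw [place_eq rfl, place_eq rfl]
  exact ((hD.tensor_right _).tensor_left _).cast _

namespace PPRSIrreducible

variable {n : ℕ}

/-- Steps are closed under contexts, so a redex in a factor or in a placed subcircuit is a redex of
the whole. Together with `right` and `of_place`, this rules out patterns inside irreducible
circuits. -/
theorem left {C D : PPCircuit n} (h : PPRSIrreducible (C * D)) : PPRSIrreducible C :=
  fun _ hE => h _ (hE.comp_left D)

theorem right {C D : PPCircuit n} (h : PPRSIrreducible (C * D)) : PPRSIrreducible D :=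
  fun _ hE => h _ (hE.comp_right C)

theorem of_place {p m : ℕ} {D : PPCircuit m} (hp : p + m ≤ n)
    (h : PPRSIrreducible (place n p D)) : PPRSIrreducible D :=
  fun _ hE => h _ (hE.place hp)

theorem not_rule {L R : PPCircuit n} (h : PPRSIrreducible L) : ¬ PPRSRule L R :=
  fun hR => h _ (.rule hR)

end PPRSIrreducible

/-! ### Triangles in terms of placed circuits -/

theorem diagonal_succ (n : ℕ) (α β : ℕ → ℝ) :
    diagonal (n + 1) α β = place (n + 2) 0 (bsStar (α 0)) * place (n + 2) 0 (phaseStar (β 0)) *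
      place (n + 2) 1 (diagonal n (fun j => α (j + 1)) (fun j => β (j + 1))) := by
  rw [diagonal, comp_eq_mul, comp_eq_mul, wires_eq_one, wires_eq_one, tensor_one,
    tensor_one, one_tensor, cast_place, cast_place, place_mul, place_place (by omega) (by omega)]

theorem triangle_succ (n : ℕ) (α β : ℕ → ℕ → ℝ) (γ : ℕ → ℝ) :
    triangle (n + 1) α β γ =
      place (n + 1) 1 (triangle n (fun i => α (i + 1)) (fun i => β (i + 1)) fun i => γ (i + 1)) *
        place (n + 1) 0 (phaseStar (γ 0)) * diagonal n (α 0) (β 0) := by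
  rw [triangle, comp_eq_mul, comp_eq_mul, wires_eq_one, wires_eq_one, tensor_one, one_tensor,
    cast_place, cast_place, mul_assoc]

/-! ### Soundness -/

namespace PPCircuit

theorem interpH_mul {n : ℕ} (D E : PPCircuit n) : (D * E).interpH = D.interpH * E.interpH := by
  induction D using Quotient.inductionOn
  induction E using Quotient.inductionOn
  rfl

theorem interpH_one (n : ℕ) : (1 : PPCircuit n).interpH = 1 := rfl

theorem interpH_tensor {n m : ℕ} (D : PPCircuit n) (E : PPCircuit m) :
    (tensor D E).interpH = directSum D.interpH E.interpH := by
  induction D using Quotient.inductionOn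
  induction E using Quotient.inductionOn
  rfl

theorem interpH_phase (φ : ℝ) : (phase φ).interpH = !![Complex.exp (Complex.I * φ)] := rfl

theorem interpH_bs (θ : ℝ) : (bs θ).interpH =
    !![Complex.cos θ, Complex.I * Complex.sin θ; Complex.I * Complex.sin θ, Complex.cos θ] := rfl

theorem interpH_cast {n m : ℕ} (h : n = m) (D : PPCircuit n) :
    (cast h D).interpH = Matrix.reindex (finCongr h) (finCongr h) D.interpH := by
  subst h
  rfl

theorem interpH_place_congr {n p m : ℕ} {D E : PPCircuit m} (h : D.interpH = E.interpH) :
    (place n p D).interpH = (place n p E).interpH := by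
  unfold place
  split_ifs
  · rw [interpH_cast, interpH_cast, interpH_tensor, interpH_tensor, interpH_tensor,
      interpH_tensor, h]
  · rfl

end PPCircuit

theorem directSum_one_by_one (A B : Matrix (Fin 1) (Fin 1) ℂ) :
    directSum A B = !![A 0 0, 0; 0, B 0 0] := by
  ext i j
  fin_cases i <;> fin_cases j <;> rfl

theorem exp_I_mul_toIcoMod (ψ : ℝ) :
    Complex.exp (Complex.I * (toIcoMod two_pi_pos 0 ψ : ℝ)) = Complex.exp (Complex.I * ψ) := by
  rw [← self_sub_toIcoDiv_zsmul, Complex.exp_eq_exp_iff_exists_int]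
  refine ⟨-toIcoDiv two_pi_pos 0 ψ, ?_⟩
  push_cast [zsmul_eq_mul]
  ring

theorem exp_I_pi : Complex.exp (Complex.I * (π : ℝ)) = -1 := by
  rw [mul_comm, Complex.exp_pi_mul_I]

theorem interpH_bs_toIcoMod (ψ : ℝ) : (bs (toIcoMod two_pi_pos 0 ψ)).interpH = (bs ψ).interpH := by
  have hs : Real.sin (toIcoMod two_pi_pos 0 ψ) = Real.sin ψ := by
    rw [← self_sub_toIcoDiv_zsmul, zsmul_eq_mul, Real.sin_sub_int_mul_two_pi]
  have hc : Real.cos (toIcoMod two_pi_pos 0 ψ) = Real.cos ψ := by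
    rw [← self_sub_toIcoDiv_zsmul, zsmul_eq_mul, Real.cos_sub_int_mul_two_pi]
  simp only [interpH_bs, ← Complex.ofReal_sin, ← Complex.ofReal_cos, hs, hc]

/-- Matrix identities of size one or two, except for `slide` and `euler`, which carry equality of
semantics as a premise. -/
theorem PPRSRule.interpH_eq {n : ℕ} {L R : PPCircuit n} (h : PPRSRule L R) :
    L.interpH = R.interpH := by
  cases h with
  | phaseMod ψ hψ => rw [interpH_phase, interpH_phase, exp_I_mul_toIcoMod]
  | bsMod ψ hψ => rw [interpH_bs_toIcoMod]
  | phaseFusion φ₁ φ₂ h₁ h₂ =>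
    simp only [comp_eq_mul, interpH_mul, interpH_phase]
    ext i j
    fin_cases i; fin_cases j
    simp [← Complex.exp_add]
    ring_nf
  | phaseZero =>
    rw [interpH_phase, wires_eq_one, interpH_one]
    ext i j
    fin_cases i; fin_cases j
    simp
  | bsZero =>
    rw [interpH_bs, wires_eq_one, interpH_one]
    ext i j
    fin_cases i <;> fin_cases j <;> simp
  | bottomPhase φ θ hφ hθ =>
    have h : Complex.exp (Complex.I * φ) * Complex.exp (-(Complex.I * φ)) = 1 := by
      rw [← Complex.exp_add, add_neg_cancel, Complex.exp_zero]
    simp only [comp_eq_mul, wires_eq_one, interpH_mul, interpH_tensor, directSum_one_by_one,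
      interpH_phase, interpH_bs, interpH_one]
    ext i j
    fin_cases i <;> fin_cases j <;> simp [Matrix.mul_apply, Fin.sum_univ_two]
    · linear_combination (-Complex.cos θ) * h
    · ring
    · linear_combination (-Complex.I * Complex.sin θ) * h
    · ring
  | topPhaseHalfPi φ hφ =>
    simp only [comp_eq_mul, wires_eq_one, interpH_mul, interpH_tensor, directSum_one_by_one,
      interpH_phase, interpH_bs, interpH_one, ← Complex.ofReal_cos, ← Complex.ofReal_sin,
      Real.cos_pi_div_two, Real.sin_pi_div_two]
    ext i j
    fin_cases i <;> fin_cases j <;> simp [Matrix.mul_apply, Fin.sum_univ_two]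
    ring
  | topPhasePi φ₀ θ₀ hφ hθ hθ' =>
    have h : Complex.exp (Complex.I * (φ₀ - π : ℝ)) = -Complex.exp (Complex.I * φ₀) := by
      rw [Complex.ofReal_sub, mul_sub, Complex.exp_sub, exp_I_pi, div_neg, div_one]
    simp only [comp_eq_mul, wires_eq_one, interpH_mul, interpH_tensor, directSum_one_by_one,
      interpH_phase, interpH_bs, interpH_one, ← Complex.ofReal_cos, ← Complex.ofReal_sin,
      Real.cos_pi_sub, Real.sin_pi_sub, h, exp_I_pi]
    ext i j
    fin_cases i <;> fin_cases j <;> simp [Matrix.mul_apply, Fin.sum_univ_two]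
  | bsSubPi θ₄ hθ =>
    simp only [comp_eq_mul, interpH_mul, interpH_tensor, directSum_one_by_one,
      interpH_phase, interpH_bs, ← Complex.ofReal_cos, ← Complex.ofReal_sin,
      Real.cos_sub_pi, Real.sin_sub_pi, exp_I_pi]
    ext i j
    fin_cases i <;> fin_cases j <;> simp [Matrix.mul_apply, Fin.sum_univ_two]
  | slide _ _ _ _ _ _ _ _ _ _ _ _ _ _ _ _ _ _ _ _ _ _ _ _ _ _ _ _ _ _ _ _ _ _ _ _ hLR =>
    exact hLR.symm
  | euler _ _ _ _ _ _ _ _ _ _ _ _ _ _ _ _ _ _ _ hLR => exact hLR.symm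

theorem PPRSStep.interpH_eq {n : ℕ} {D D' : PPCircuit n} (h : PPRSStep D D') :
    D.interpH = D'.interpH := by
  induction h with
  | rule h => exact h.interpH_eq
  | comp_left E _ ih | comp_right E _ ih => simp only [comp_eq_mul, interpH_mul, ih]
  | tensor_left E _ ih | tensor_right E _ ih => simp only [interpH_tensor, ih]

/-! ### Termination -/

open Classical in
/-- The weight of the angle of a beam splitter in the termination measure. -/
def bsWeight (θ : ℝ) : ℕ :=
  if θ ∈ Set.Ico 0 π then 1 else if θ ∈ Set.Ico 0 (2 * π) then 2 else 3

open Classical in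
/-- The weight of the angle of a phase shifter in the termination measure. -/
def phaseWeight (φ : ℝ) : ℕ :=
  if φ ∈ Set.Ico 0 π then 4 else if φ ∈ Set.Ico 0 (2 * π) then 6 else 8

namespace PPTerm

/-- The total weight of the beam splitters. -/
def bsTotal : {n : ℕ} → PPTerm n → ℕ
  | _, .id _ => 0
  | _, .phase _ => 0
  | _, .bs θ => bsWeight θ
  | _, .comp D₂ D₁ => D₂.bsTotal + D₁.bsTotal
  | _, .tensor D₁ D₂ => D₁.bsTotal + D₂.bsTotal

/-- The total weight of the beam splitters, each multiplied by the number of wires below it. -/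
def bsHeight : {n : ℕ} → PPTerm n → ℕ
  | _, .id _ => 0
  | _, .phase _ => 0
  | _, .bs _ => 0
  | _, .comp D₂ D₁ => D₂.bsHeight + D₁.bsHeight
  | _, .tensor (m := m) D₁ D₂ => D₁.bsHeight + D₁.bsTotal * m + D₂.bsHeight

/-- For a circuit on the modes `p, p + 1, …`, the weights of the input wires in terms of the
weights of the output wires. -/
def wireWeight : {n : ℕ} → PPTerm n → ℕ → (ℕ → ℕ) → ℕ → ℕ
  | _, .id _, _, w => w
  | _, .phase _, _, w => w
  -- A bottom input must outweigh a top input so that `bottomPhase` decreases, and both must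
  -- outweigh the outputs. The factors `4` and `50` are convenient, not optimal.
  | _, .bs _, p, w => fun k =>
      if k = p then 4 * (w p + w (p + 1))
      else if k = p + 1 then 50 * (w p + w (p + 1)) else w k
  | _, .comp D₂ D₁, p, w => D₁.wireWeight p (D₂.wireWeight p w)
  | _, .tensor (n := n) D₁ D₂, p, w => D₂.wireWeight (p + n) (D₁.wireWeight p w)

/-- The total weight of the phase shifters, each multiplied by the weight of its wire. -/
def phaseTotal : {n : ℕ} → PPTerm n → ℕ → (ℕ → ℕ) → ℕ
  | _, .id _, _, _ => 0
  | _, .phase φ, p, w => phaseWeight φ * w p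
  | _, .bs _, _, _ => 0
  | _, .comp D₂ D₁, p, w => D₂.phaseTotal p w + D₁.phaseTotal p (D₂.wireWeight p w)
  | _, .tensor (n := n) D₁ D₂, p, w => D₁.phaseTotal p w + D₂.phaseTotal (p + n) w

theorem wireWeight_of_notMem {n : ℕ} (D : PPTerm n) (p : ℕ) (w : ℕ → ℕ) (k : ℕ)
    (hk : k < p ∨ p + n ≤ k) : D.wireWeight p w k = w k := by
  induction D generalizing p w with
  | id n => rfl
  | phase φ => rfl
  | bs θ =>
    simp only [wireWeight]
    rw [if_neg (by omega), if_neg (by omega)]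
  | comp D₂ D₁ ih₂ ih₁ => rw [wireWeight, ih₁ _ _ hk, ih₂ _ _ hk]
  | tensor D₁ D₂ ih₁ ih₂ => rw [wireWeight, ih₂ _ _ (by omega), ih₁ _ _ (by omega)]

theorem wireWeight_congr {n : ℕ} (D : PPTerm n) (p : ℕ) (w w' : ℕ → ℕ)
    (h : ∀ k, p ≤ k → k < p + n → w k = w' k) (k : ℕ) (hk : p ≤ k) (hk' : k < p + n) :
    D.wireWeight p w k = D.wireWeight p w' k := by
  induction D generalizing p w w' k with
  | id n => exact h k hk hk'
  | phase φ => exact h k hk hk'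
  | bs θ =>
    simp only [wireWeight]
    rw [h p (by omega) (by omega), h (p + 1) (by omega) (by omega), h k hk hk']
  | comp D₂ D₁ ih₂ ih₁ => exact ih₁ _ _ _ (ih₂ _ _ _ h) _ hk hk'
  | @tensor n m D₁ D₂ ih₁ ih₂ =>
    simp only [wireWeight]
    by_cases hkn : k < p + n
    · rw [wireWeight_of_notMem _ _ _ _ (.inl hkn), wireWeight_of_notMem _ _ _ _ (.inl hkn)]
      exact ih₁ _ _ _ (fun k h₁ h₂ => h k h₁ (by omega)) _ hk hkn
    · refine ih₂ _ _ _ (fun k h₁ h₂ => ?_) _ (by omega) (by omega)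
      rw [wireWeight_of_notMem _ _ _ _ (.inr h₁), wireWeight_of_notMem _ _ _ _ (.inr h₁)]
      exact h k (by omega) (by omega)

/-- Each circuit reads and changes weights only on its own modes, and the two blocks are disjoint.
This is what the interchange law demands of the weights. -/
theorem wireWeight_comm {n m : ℕ} (D : PPTerm n) (E : PPTerm m) (p q : ℕ) (hpq : p + n ≤ q)
    (w : ℕ → ℕ) :
    D.wireWeight p (E.wireWeight q w) = E.wireWeight q (D.wireWeight p w) := by
  funext k
  by_cases hk : p ≤ k ∧ k < p + n
  · rw [wireWeight_of_notMem E _ _ _ (by omega)]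
    exact wireWeight_congr _ _ _ _ (fun j _ _ => wireWeight_of_notMem _ _ _ _ (by omega)) _
      hk.1 hk.2
  · rw [wireWeight_of_notMem D _ _ _ (by omega)]
    by_cases hk' : q ≤ k ∧ k < q + m
    · exact wireWeight_congr _ _ _ _
        (fun j _ _ => (wireWeight_of_notMem _ _ _ _ (by omega)).symm) _ hk'.1 hk'.2
    · rw [wireWeight_of_notMem E _ _ _ (by omega), wireWeight_of_notMem E _ _ _ (by omega),
        wireWeight_of_notMem D _ _ _ (by omega)]

theorem phaseTotal_congr {n : ℕ} (D : PPTerm n) (p : ℕ) (w w' : ℕ → ℕ)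
    (h : ∀ k, p ≤ k → k < p + n → w k = w' k) : D.phaseTotal p w = D.phaseTotal p w' := by
  induction D generalizing p w w' with
  | id n => rfl
  | phase φ => rw [phaseTotal, phaseTotal, h p le_rfl (by omega)]
  | bs θ => rfl
  | comp D₂ D₁ ih₂ ih₁ =>
    rw [phaseTotal, phaseTotal, ih₂ _ _ _ h, ih₁ _ _ _ (wireWeight_congr D₂ _ _ _ h)]
  | tensor D₁ D₂ ih₁ ih₂ =>
    rw [phaseTotal, phaseTotal, ih₁ _ _ _ fun k h₁ h₂ => h k h₁ (by omega),
      ih₂ _ _ _ fun k h₁ h₂ => h k (by omega) (by omega)]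

theorem wireWeight_pos {n : ℕ} (D : PPTerm n) (p : ℕ) (w : ℕ → ℕ) (hw : ∀ k, 0 < w k) (k : ℕ) :
    0 < D.wireWeight p w k := by
  induction D generalizing p w k with
  | id n => exact hw k
  | phase φ => exact hw k
  | bs θ =>
    have := hw p
    have := hw k
    simp only [wireWeight]
    split_ifs <;> omega
  | comp D₂ D₁ ih₂ ih₁ => exact ih₁ _ _ (ih₂ _ _ hw) _
  | tensor D₁ D₂ ih₁ ih₂ => exact ih₂ _ _ (ih₁ _ _ hw) _

theorem bsTotal_cast {n m : ℕ} (h : n = m) (D : PPTerm n) : (D.cast h).bsTotal = D.bsTotal := by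
  subst h
  rfl

theorem bsHeight_cast {n m : ℕ} (h : n = m) (D : PPTerm n) :
    (D.cast h).bsHeight = D.bsHeight := by
  subst h
  rfl

theorem wireWeight_cast {n m : ℕ} (h : n = m) (D : PPTerm n) :
    (D.cast h).wireWeight = D.wireWeight := by
  subst h
  rfl

theorem phaseTotal_cast {n m : ℕ} (h : n = m) (D : PPTerm n) :
    (D.cast h).phaseTotal = D.phaseTotal := by
  subst h
  rfl

end PPTerm

/-! ### Invariance of the termination measure under deformation. -/

open PPTerm in
theorem PROEq.bsTotal_eq {n : ℕ} {D E : PPTerm n} (h : PROEq D E) : D.bsTotal = E.bsTotal := by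
  induction h with
  | symm _ ih => exact ih.symm
  | trans _ _ ih₁ ih₂ => exact ih₁.trans ih₂
  | _ => simp only [bsTotal, bsTotal_cast, *] <;> omega

open PPTerm in
theorem PROEq.bsHeight_eq {n : ℕ} {D E : PPTerm n} (h : PROEq D E) :
    D.bsHeight = E.bsHeight := by
  induction h with
  | refl D => rfl
  | symm _ ih => exact ih.symm
  | trans _ _ ih₁ ih₂ => exact ih₁.trans ih₂
  | tensor_congr h₁ h₂ ih₁ ih₂ => simp only [bsHeight, ih₁, ih₂, h₁.bsTotal_eq]
  | _ => simp only [bsTotal, bsHeight, bsHeight_cast, *] <;> ring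

open PPTerm in
theorem PROEq.wireWeight_eq {n : ℕ} {D E : PPTerm n} (h : PROEq D E) :
    D.wireWeight = E.wireWeight := by
  induction h with
  | refl D => rfl
  | symm _ ih => exact ih.symm
  | trans _ _ ih₁ ih₂ => exact ih₁.trans ih₂
  | comp_congr _ _ ih₁ ih₂ | tensor_congr _ _ ih₁ ih₂ =>
    funext p w
    simp only [wireWeight, ih₁, ih₂]
  | interchange D₂ D₁ E₂ E₁ =>
    funext p w
    simp only [wireWeight]
    rw [wireWeight_comm D₁ E₂ _ _ le_rfl]
  | _ =>
    funext p w
    simp only [wireWeight, wireWeight_cast, Nat.add_assoc, Nat.add_zero]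

open PPTerm in
theorem PROEq.phaseTotal_eq {n : ℕ} {D E : PPTerm n} (h : PROEq D E) :
    D.phaseTotal = E.phaseTotal := by
  induction h with
  | refl D => rfl
  | symm _ ih => exact ih.symm
  | trans _ _ ih₁ ih₂ => exact ih₁.trans ih₂
  | comp_congr h₁ h₂ ih₁ ih₂ | tensor_congr h₁ h₂ ih₁ ih₂ =>
    funext p w
    simp only [phaseTotal, ih₁, ih₂, h₁.wireWeight_eq]
  | @interchange n m D₂ D₁ E₂ E₁ =>
    funext p w
    simp only [phaseTotal, wireWeight]
    -- The two sides differ only in weight changes on the other block of modes, which a factor does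
    -- not see.
    rw [phaseTotal_congr D₁ p (E₂.wireWeight (p + n) (D₂.wireWeight p w)) (D₂.wireWeight p w)
        fun k _ _ => wireWeight_of_notMem _ _ _ _ (by omega),
      ← wireWeight_comm D₂ E₂ _ _ le_rfl,
      phaseTotal_congr E₁ (p + n) (D₂.wireWeight p (E₂.wireWeight (p + n) w))
        (E₂.wireWeight (p + n) w) fun k _ _ => wireWeight_of_notMem _ _ _ _ (by omega)]
    have : E₂.phaseTotal (p + n) (D₁.wireWeight p (D₂.wireWeight p w)) =
        E₂.phaseTotal (p + n) w := phaseTotal_congr _ _ _ _ fun k _ _ => by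
      rw [wireWeight_of_notMem _ _ _ _ (by omega), wireWeight_of_notMem _ _ _ _ (by omega)]
    omega
  | _ =>
    funext p w
    simp only [phaseTotal, wireWeight, phaseTotal_cast, Nat.add_assoc, Nat.add_zero, Nat.zero_add]

/-! ### The termination measure on circuits. -/

namespace PPCircuit

/-- The total weight of the beam splitters of a circuit. -/
def bsTotal {n : ℕ} (D : PPCircuit n) : ℕ :=
  Quotient.lift PPTerm.bsTotal (fun _ _ h => PROEq.bsTotal_eq h) D

/-- The total weight of the beam splitters of a circuit, each multiplied by the number of wires
below it. -/
def bsHeight {n : ℕ} (D : PPCircuit n) : ℕ :=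
  Quotient.lift PPTerm.bsHeight (fun _ _ h => PROEq.bsHeight_eq h) D

/-- The weights of the input wires of a circuit in terms of those of its output wires. -/
def wireWeight {n : ℕ} (D : PPCircuit n) : ℕ → (ℕ → ℕ) → ℕ → ℕ :=
  Quotient.lift PPTerm.wireWeight (fun _ _ h => PROEq.wireWeight_eq h) D

/-- The total weight of the phase shifters of a circuit, each multiplied by the weight of its
wire. -/
def phaseTotal {n : ℕ} (D : PPCircuit n) : ℕ → (ℕ → ℕ) → ℕ :=
  Quotient.lift PPTerm.phaseTotal (fun _ _ h => PROEq.phaseTotal_eq h) D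

variable {n m : ℕ}

theorem bsTotal_wires : (wires n).bsTotal = 0 := rfl
theorem bsTotal_phase (φ : ℝ) : (phase φ).bsTotal = 0 := rfl
theorem bsTotal_bs (θ : ℝ) : (bs θ).bsTotal = bsWeight θ := rfl

theorem bsTotal_comp (D E : PPCircuit n) : (comp D E).bsTotal = D.bsTotal + E.bsTotal := by
  induction D using Quotient.inductionOn
  induction E using Quotient.inductionOn
  rfl

theorem bsTotal_tensor (D : PPCircuit n) (E : PPCircuit m) :
    (tensor D E).bsTotal = D.bsTotal + E.bsTotal := by
  induction D using Quotient.inductionOn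
  induction E using Quotient.inductionOn
  rfl

theorem bsHeight_wires : (wires n).bsHeight = 0 := rfl
theorem bsHeight_phase (φ : ℝ) : (phase φ).bsHeight = 0 := rfl
theorem bsHeight_bs (θ : ℝ) : (bs θ).bsHeight = 0 := rfl

theorem bsHeight_comp (D E : PPCircuit n) : (comp D E).bsHeight = D.bsHeight + E.bsHeight := by
  induction D using Quotient.inductionOn
  induction E using Quotient.inductionOn
  rfl

theorem bsHeight_tensor (D : PPCircuit n) (E : PPCircuit m) :
    (tensor D E).bsHeight = D.bsHeight + D.bsTotal * m + E.bsHeight := by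
  induction D using Quotient.inductionOn
  induction E using Quotient.inductionOn
  rfl

theorem wireWeight_wires (p : ℕ) (w : ℕ → ℕ) : (wires n).wireWeight p w = w := rfl
theorem wireWeight_phase (φ : ℝ) (p : ℕ) (w : ℕ → ℕ) : (phase φ).wireWeight p w = w := rfl

theorem wireWeight_bs (θ : ℝ) (p : ℕ) (w : ℕ → ℕ) : (bs θ).wireWeight p w = fun k =>
    if k = p then 4 * (w p + w (p + 1))
    else if k = p + 1 then 50 * (w p + w (p + 1)) else w k := rfl

theorem wireWeight_comp (D E : PPCircuit n) (p : ℕ) (w : ℕ → ℕ) :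
    (comp D E).wireWeight p w = E.wireWeight p (D.wireWeight p w) := by
  induction D using Quotient.inductionOn
  induction E using Quotient.inductionOn
  rfl

theorem wireWeight_tensor (D : PPCircuit n) (E : PPCircuit m) (p : ℕ) (w : ℕ → ℕ) :
    (tensor D E).wireWeight p w = E.wireWeight (p + n) (D.wireWeight p w) := by
  induction D using Quotient.inductionOn
  induction E using Quotient.inductionOn
  rfl

theorem wireWeight_pos (D : PPCircuit n) (p : ℕ) (w : ℕ → ℕ) (hw : ∀ k, 0 < w k) (k : ℕ) :
    0 < D.wireWeight p w k := by
  induction D using Quotient.inductionOn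
  exact PPTerm.wireWeight_pos _ _ _ hw _

theorem phaseTotal_wires (p : ℕ) (w : ℕ → ℕ) : (wires n).phaseTotal p w = 0 := rfl
theorem phaseTotal_phase (φ : ℝ) (p : ℕ) (w : ℕ → ℕ) :
    (phase φ).phaseTotal p w = phaseWeight φ * w p := rfl
theorem phaseTotal_bs (θ : ℝ) (p : ℕ) (w : ℕ → ℕ) : (bs θ).phaseTotal p w = 0 := rfl

theorem phaseTotal_comp (D E : PPCircuit n) (p : ℕ) (w : ℕ → ℕ) :
    (comp D E).phaseTotal p w = D.phaseTotal p w + E.phaseTotal p (D.wireWeight p w) := by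
  induction D using Quotient.inductionOn
  induction E using Quotient.inductionOn
  rfl

theorem phaseTotal_tensor (D : PPCircuit n) (E : PPCircuit m) (p : ℕ) (w : ℕ → ℕ) :
    (tensor D E).phaseTotal p w = D.phaseTotal p w + E.phaseTotal (p + n) w := by
  induction D using Quotient.inductionOn
  induction E using Quotient.inductionOn
  rfl

theorem bsTotal_phaseOpt (o : Option ℝ) : (phaseOpt o).bsTotal = 0 := by cases o <;> rfl
theorem bsHeight_phaseOpt (o : Option ℝ) : (phaseOpt o).bsHeight = 0 := by cases o <;> rfl

/-- The order by which every rewrite step decreases. -/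
def Decreases (D D' : PPCircuit n) : Prop :=
  D'.bsTotal < D.bsTotal ∨
  (D'.bsTotal = D.bsTotal ∧ D'.bsHeight < D.bsHeight) ∨
  (D'.bsTotal = D.bsTotal ∧ D'.bsHeight = D.bsHeight ∧ D'.wireWeight = D.wireWeight ∧
    ∀ (p : ℕ) (w : ℕ → ℕ), (∀ k, 0 < w k) → D'.phaseTotal p w < D.phaseTotal p w)

end PPCircuit

/-! ### Decrease of the measure along rules and steps. -/

theorem bsWeight_of_mem_Ico {θ : ℝ} (h : θ ∈ Set.Ico 0 π) : bsWeight θ = 1 := if_pos h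

theorem bsWeight_of_mem_Ioo {θ : ℝ} (h : θ ∈ Set.Ioo 0 π) : bsWeight θ = 1 :=
  if_pos (Set.Ioo_subset_Ico_self h)

theorem bsWeight_le {θ : ℝ} (h : θ ∈ Set.Ico 0 (2 * π)) : bsWeight θ ≤ 2 := by
  unfold bsWeight
  split_ifs <;> omega

theorem bsWeight_of_notMem {θ : ℝ} (h : θ ∉ Set.Ico 0 (2 * π)) : bsWeight θ = 3 := by
  unfold bsWeight
  rw [if_neg fun h' => h ⟨h'.1, by linarith [h'.2, pi_pos]⟩, if_neg h]

theorem four_le_phaseWeight (φ : ℝ) : 4 ≤ phaseWeight φ := by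
  unfold phaseWeight
  split_ifs <;> omega

theorem phaseWeight_le_eight (φ : ℝ) : phaseWeight φ ≤ 8 := by
  unfold phaseWeight
  split_ifs <;> omega

theorem phaseWeight_le_six {φ : ℝ} (h : φ ∈ Set.Ico 0 (2 * π)) : phaseWeight φ ≤ 6 := by
  unfold phaseWeight
  split_ifs <;> omega

theorem phaseWeight_of_notMem {φ : ℝ} (h : φ ∉ Set.Ico 0 (2 * π)) : phaseWeight φ = 8 := by
  unfold phaseWeight
  rw [if_neg fun h' => h ⟨h'.1, by linarith [h'.2, pi_pos]⟩, if_neg h]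

theorem phaseWeight_of_mem_Ico {φ : ℝ} (h : φ ∈ Set.Ico 0 π) : phaseWeight φ = 4 := if_pos h

theorem phaseWeight_of_pi_le {φ : ℝ} (h : π ≤ φ) (h' : φ < 2 * π) : phaseWeight φ = 6 := by
  unfold phaseWeight
  rw [if_neg fun h₁ => h₁.2.not_ge h, if_pos ⟨pi_pos.le.trans h, h'⟩]

/-- If the sum stays below `2π`, then at most `6` replaces at least `4 + 4`. Otherwise one summand
is at least `π`, and at most `8` replaces at least `4 + 6`. -/
theorem phaseWeight_add_lt {φ₁ φ₂ : ℝ} (h₁ : φ₁ ∈ Set.Ioo 0 (2 * π)) (h₂ : φ₂ ∈ Set.Ioo 0 (2 * π)) :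
    phaseWeight (φ₁ + φ₂) < phaseWeight φ₁ + phaseWeight φ₂ := by
  have h1 := four_le_phaseWeight φ₁
  have h2 := four_le_phaseWeight φ₂
  by_cases h : φ₁ + φ₂ < 2 * π
  · have := phaseWeight_le_six (φ := φ₁ + φ₂) ⟨by linarith [h₁.1, h₂.1], h⟩
    omega
  · have := phaseWeight_le_eight (φ₁ + φ₂)
    rcases lt_or_ge φ₁ π with h' | h'
    · have := phaseWeight_of_pi_le (φ := φ₂) (by linarith) h₂.2
      omega
    · have := phaseWeight_of_pi_le h' h₁.2
      omega

theorem toIcoMod_two_pi_mem (ψ : ℝ) : toIcoMod two_pi_pos 0 ψ ∈ Set.Ico 0 (2 * π) := by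
  simpa using toIcoMod_mem_Ico two_pi_pos 0 ψ

/-- The beam splitter weight drops under `bsMod`, `bsZero`, `bsSubPi` and `euler`; the height drops
under `slide`; the phase sum drops under all other rules, which leave the wire weights alone. -/
theorem PPRSRule.decreases {n : ℕ} {L R : PPCircuit n} (h : PPRSRule L R) : L.Decreases R := by
  have hπ := pi_pos
  cases h with
  | phaseMod ψ hψ =>
    refine .inr (.inr ⟨rfl, rfl, rfl, fun p w hw => ?_⟩)
    rw [phaseTotal_phase, phaseTotal_phase, phaseWeight_of_notMem hψ]
    exact Nat.mul_lt_mul_of_pos_right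
      ((phaseWeight_le_six (toIcoMod_two_pi_mem ψ)).trans_lt (by omega)) (hw p)
  | bsMod ψ hψ =>
    refine .inl ?_
    rw [bsTotal_bs, bsTotal_bs, bsWeight_of_notMem hψ]
    exact (bsWeight_le (toIcoMod_two_pi_mem ψ)).trans_lt (by omega)
  | phaseFusion φ₁ φ₂ h₁ h₂ =>
    refine .inr (.inr ⟨rfl, rfl, rfl, fun p w hw => ?_⟩)
    rw [phaseTotal_comp, phaseTotal_phase, phaseTotal_phase, phaseTotal_phase, wireWeight_phase,
      ← add_mul, add_comm (phaseWeight _)]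
    exact Nat.mul_lt_mul_of_pos_right (phaseWeight_add_lt h₁ h₂) (hw p)
  | phaseZero =>
    refine .inr (.inr ⟨rfl, rfl, rfl, fun p w hw => ?_⟩)
    have := four_le_phaseWeight 0
    exact Nat.mul_pos (by omega) (hw p)
  | bsZero =>
    refine .inl ?_
    rw [bsTotal_bs, bsWeight_of_mem_Ico ⟨le_rfl, hπ⟩]
    exact one_pos
  | bottomPhase φ θ hφ hθ =>
    refine .inr (.inr ⟨?_, ?_, ?_, fun p w hw => ?_⟩)
    · simp [bsTotal_comp, bsTotal_tensor, bsTotal_phase, bsTotal_wires]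
    · simp [bsHeight_comp, bsHeight_tensor, bsHeight_phase, bsHeight_wires, bsTotal_phase,
        bsTotal_wires]
    · funext p w
      simp [wireWeight_comp, wireWeight_tensor, wireWeight_phase, wireWeight_wires, wireWeight_bs]
    · simp only [phaseTotal_comp, phaseTotal_tensor, phaseTotal_phase, phaseTotal_wires,
        wireWeight_tensor, wireWeight_phase, wireWeight_bs,
        phaseTotal_bs]
      -- With output weights of sum `s` and `W` the weight of `φ`, the phase sum goes from `50 * W *
      -- s` to at most `W * s + 8 * 4 * s`, which is smaller because `W ≥ 4`.
      have h₁ := phaseWeight_le_six (Set.Ioo_subset_Ico_self hφ)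
      have h₂ := phaseWeight_le_eight (-φ)
      have h₃ := four_le_phaseWeight φ
      have := hw p
      have := hw (p + 1)
      simp
      nlinarith
  | topPhaseHalfPi φ hφ =>
    refine .inr (.inr ⟨?_, ?_, ?_, fun p w hw => ?_⟩)
    · simp [bsTotal_comp, bsTotal_tensor, bsTotal_phase, bsTotal_wires]
    · simp [bsHeight_comp, bsHeight_tensor, bsHeight_phase, bsHeight_wires, bsTotal_phase,
        bsTotal_wires]
    · funext p w
      simp [wireWeight_comp, wireWeight_tensor, wireWeight_phase, wireWeight_wires, wireWeight_bs]
    · simp only [phaseTotal_comp, phaseTotal_tensor, phaseTotal_phase, phaseTotal_wires,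
        wireWeight_tensor, wireWeight_phase, wireWeight_wires, wireWeight_bs, phaseTotal_bs]
      have h₃ := four_le_phaseWeight φ
      have := hw p
      have := hw (p + 1)
      simp
      nlinarith
  | topPhasePi φ₀ θ₀ hφ hθ hθ' =>
    have h₁ := bsWeight_of_mem_Ioo hθ
    have h₂ : bsWeight (π - θ₀) = 1 :=
      bsWeight_of_mem_Ioo ⟨by linarith [hθ.2], by linarith [hθ.1]⟩
    refine .inr (.inr ⟨?_, ?_, ?_, fun p w hw => ?_⟩)
    · simp [bsTotal_comp, bsTotal_tensor, bsTotal_phase, bsTotal_wires, bsTotal_bs, h₁, h₂]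
    · simp [bsHeight_comp, bsHeight_tensor, bsHeight_phase, bsHeight_wires, bsTotal_phase,
        bsTotal_wires, bsHeight_bs]
    · funext p w
      simp [wireWeight_comp, wireWeight_tensor, wireWeight_phase, wireWeight_wires, wireWeight_bs]
    -- With output weights `a`, `b`, the sum goes from `6 * 4 * (a + b)` to `6 * b + 4 * 4 * (a +
    -- b)`.
    · simp only [phaseTotal_comp, phaseTotal_tensor, phaseTotal_phase, phaseTotal_wires,
        wireWeight_tensor, wireWeight_phase, wireWeight_wires, wireWeight_bs,
        phaseTotal_bs, phaseWeight_of_pi_le hφ.1 hφ.2, phaseWeight_of_pi_le le_rfl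
        (by linarith : π < 2 * π), phaseWeight_of_mem_Ico (φ := φ₀ - π)
        ⟨by linarith [hφ.1], by linarith [hφ.2]⟩]
      have := hw p
      have := hw (p + 1)
      simp
      omega
  | bsSubPi θ₄ hθ =>
    refine .inl ?_
    have h₁ : bsWeight (θ₄ - π) = 1 :=
      bsWeight_of_mem_Ico ⟨by linarith [hθ.1], by linarith [hθ.2]⟩
    have h₂ : bsWeight θ₄ = 2 := by
      unfold bsWeight
      rw [if_neg fun h => h.2.not_ge hθ.1, if_pos ⟨hπ.le.trans hθ.1, hθ.2⟩]
    simp [bsTotal_comp, bsTotal_tensor, bsTotal_phase, bsTotal_bs, h₁, h₂]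
  | slide θ₁ θ₂ θ₃ φ₁ φ₂ α₁ α₂ α₃ β₁ β₂ β₃ β₄ β₅ β₆ hθ₁ hθ₂ hθ₃ hφ₁ hφ₂ hα₁ hα₂ hα₃ hβ₁ hβ₂ hβ₃
      hβ₄ hβ₅ hβ₆ h₁ h₂ h₃ h₂₁ _ _ hL hR hLR =>
    subst hL hR
    -- Both sides have three beam splitters of weight `1`, since angle `0` also counts `1`. Two of
    -- them have a wire below on the left, only one on the right.
    refine .inr (.inl ⟨?_, ?_⟩)
    · simp [bsTotal_comp, bsTotal_tensor, bsTotal_phase, bsTotal_wires, bsTotal_bs, onTop,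
        onBottom, parallel3, bsTotal_phaseOpt, bsWeight_of_mem_Ioo hθ₁, bsWeight_of_mem_Ioo hθ₂,
        bsWeight_of_mem_Ioo hθ₃, bsWeight_of_mem_Ico hα₁, bsWeight_of_mem_Ico hα₂,
        bsWeight_of_mem_Ico hα₃]
    · simp [bsTotal_comp, bsTotal_tensor, bsTotal_phase, bsTotal_wires, bsTotal_bs, onTop,
        onBottom, parallel3, bsTotal_phaseOpt, bsWeight_of_mem_Ioo hθ₁,
        bsWeight_of_mem_Ioo hθ₃, bsWeight_of_mem_Ico hα₂,
        bsHeight_comp, bsHeight_tensor, bsHeight_phase, bsHeight_wires,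
        bsHeight_bs, bsHeight_phaseOpt]
  | euler θ₁ θ₂ φ₁ α₁ β₁ β₂ β₃ hθ₁ hθ₂ hφ₁ hα₁ hβ₁ hβ₂ hβ₃ h₁ _ _ hL hR hLR =>
    subst hL hR
    refine .inl ?_
    simp [bsTotal_comp, bsTotal_tensor, bsTotal_phase, bsTotal_wires, bsTotal_bs,
      bsTotal_phaseOpt, bsWeight_of_mem_Ioo hθ₁, bsWeight_of_mem_Ioo hθ₂, bsWeight_of_mem_Ico hα₁]

/-- The last clause of `Decreases` is shaped for contexts: a circuit acting later changes `w`, one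
placed above changes `p`, and one acting earlier sees the same weights because `wireWeight` is
preserved. Height is compared only at equal beam splitter weight, since wires added below multiply
that weight. -/
theorem PPRSStep.decreases {n : ℕ} {D D' : PPCircuit n} (h : PPRSStep D D') : D.Decreases D' := by
  induction h with
  | rule h => exact h.decreases
  | comp_left E _ ih =>
    rcases ih with h | ⟨h₁, h₂⟩ | ⟨h₁, h₂, h₃, h₄⟩
    · exact .inl (by simpa only [bsTotal_comp, add_lt_add_iff_right])
    · exact .inr (.inl (by simpa only [bsTotal_comp, bsHeight_comp, add_lt_add_iff_right, h₁,
        true_and]))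
    · refine .inr (.inr ⟨by rw [bsTotal_comp, bsTotal_comp, h₁],
        by rw [bsHeight_comp, bsHeight_comp, h₂], ?_, fun p w hw => ?_⟩)
      · funext p w
        rw [wireWeight_comp, wireWeight_comp, h₃]
      · rw [phaseTotal_comp, phaseTotal_comp, h₃]
        exact Nat.add_lt_add_right (h₄ p w hw) _
  | comp_right E _ ih =>
    rcases ih with h | ⟨h₁, h₂⟩ | ⟨h₁, h₂, h₃, h₄⟩
    · exact .inl (by simpa only [bsTotal_comp, add_lt_add_iff_left])
    · exact .inr (.inl (by simpa only [bsTotal_comp, bsHeight_comp, add_lt_add_iff_left, h₁,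
        true_and]))
    · refine .inr (.inr ⟨by rw [bsTotal_comp, bsTotal_comp, h₁],
        by rw [bsHeight_comp, bsHeight_comp, h₂], ?_, fun p w hw => ?_⟩)
      · funext p w
        rw [wireWeight_comp, wireWeight_comp, h₃]
      · rw [phaseTotal_comp, phaseTotal_comp]
        exact Nat.add_lt_add_left (h₄ _ _ (wireWeight_pos E p w hw)) _
  | tensor_left E _ ih =>
    rcases ih with h | ⟨h₁, h₂⟩ | ⟨h₁, h₂, h₃, h₄⟩
    · exact .inl (by simpa only [bsTotal_tensor, add_lt_add_iff_right])
    · exact .inr (.inl (by simpa only [bsTotal_tensor, bsHeight_tensor, add_lt_add_iff_right, h₁,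
        true_and]))
    · refine .inr (.inr ⟨by rw [bsTotal_tensor, bsTotal_tensor, h₁],
        by rw [bsHeight_tensor, bsHeight_tensor, h₁, h₂], ?_, fun p w hw => ?_⟩)
      · funext p w
        rw [wireWeight_tensor, wireWeight_tensor, h₃]
      · rw [phaseTotal_tensor, phaseTotal_tensor]
        exact Nat.add_lt_add_right (h₄ p w hw) _
  | tensor_right E _ ih =>
    rcases ih with h | ⟨h₁, h₂⟩ | ⟨h₁, h₂, h₃, h₄⟩
    · exact .inl (by simpa only [bsTotal_tensor, add_lt_add_iff_left])
    · exact .inr (.inl (by simpa only [bsTotal_tensor, bsHeight_tensor, add_lt_add_iff_left, h₁,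
        true_and]))
    · refine .inr (.inr ⟨by rw [bsTotal_tensor, bsTotal_tensor, h₁],
        by rw [bsHeight_tensor, bsHeight_tensor, h₂], ?_, fun p w hw => ?_⟩)
      · funext p w
        rw [wireWeight_tensor, wireWeight_tensor, h₃]
      · rw [phaseTotal_tensor, phaseTotal_tensor]
        exact Nat.add_lt_add_left (h₄ _ w hw) _

/-- PPRS is strongly normalising. -/
theorem PPRSStep.wellFounded (n : ℕ) : WellFounded fun D' D : PPCircuit n => PPRSStep D D' := by
  -- For a whole circuit it is enough to start at mode `0` with weight `1` on every output.
  refine Subrelation.wf (fun {D' D} h => ?_) (InvImage.wf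
    (fun D : PPCircuit n => (toLex (D.bsTotal, toLex (D.bsHeight, D.phaseTotal 0 fun _ => 1))))
    wellFounded_lt)
  rcases h.decreases with h | ⟨h₁, h₂⟩ | ⟨h₁, h₂, -, h₄⟩
  · exact Prod.Lex.left _ _ h
  · simp only [InvImage, h₁]
    exact Prod.Lex.right _ (Prod.Lex.left _ _ h₂)
  · simp only [InvImage, h₁, h₂]
    exact Prod.Lex.right _ (Prod.Lex.right _ (h₄ 0 _ fun _ => one_pos))

theorem exists_isPPRSNormalFormOf {n : ℕ} (C : PPCircuit n) : ∃ N, IsPPRSNormalFormOf N C := by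
  induction C using (PPRSStep.wellFounded n).induction with
  | _ C ih =>
    by_cases h : PPRSIrreducible C
    · exact ⟨C, .refl, h⟩
    · obtain ⟨D, hD⟩ : ∃ D, PPRSStep C D := by
        simpa only [PPRSIrreducible, not_forall, not_not] using h
      obtain ⟨N, hN, hN'⟩ := ih D hD
      exact ⟨N, .head hD hN, hN'⟩

/-! ### Semantics of triangles -/

theorem norm_exp_I_mul (x : ℝ) : ‖Complex.exp (Complex.I * x)‖ = 1 := by
  rw [mul_comm, Complex.norm_exp_ofReal_mul_I]

theorem star_exp_I_mul (x : ℝ) :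
    star (Complex.exp (Complex.I * x)) * Complex.exp (Complex.I * x) = 1 := by
  have := Complex.conj_mul' (Complex.exp (Complex.I * x))
  rw [norm_exp_I_mul] at this
  simpa using this

theorem PPTerm.interpH_mem_unitaryGroup {n : ℕ} (D : PPTerm n) :
    D.interpH ∈ Matrix.unitaryGroup (Fin n) ℂ := by
  induction D with
  | id n => exact one_mem _
  | phase φ =>
    rw [Matrix.mem_unitaryGroup_iff']
    ext i j
    fin_cases i; fin_cases j
    simpa [PPTerm.interpH, Matrix.mul_apply] using star_exp_I_mul φ
  | bs θ =>
    have h : (Complex.cos θ) ^ 2 + (Complex.sin θ) ^ 2 = 1 := Complex.cos_sq_add_sin_sq _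
    rw [Matrix.mem_unitaryGroup_iff']
    ext i j
    fin_cases i <;> fin_cases j <;>
      simp [PPTerm.interpH, Matrix.mul_apply, Fin.sum_univ_two, ← Complex.cos_conj,
        ← Complex.sin_conj]
    · linear_combination h - Complex.sin θ ^ 2 * Complex.I_sq
    · ring
    · ring
    · linear_combination h - Complex.sin θ ^ 2 * Complex.I_sq
  | comp D₂ D₁ ih₂ ih₁ => exact mul_mem ih₂ ih₁
  | tensor D₁ D₂ ih₁ ih₂ =>
    rw [Matrix.mem_unitaryGroup_iff, Matrix.star_eq_conjTranspose] at *
    simp only [PPTerm.interpH, directSum, Matrix.reindex_apply, Matrix.conjTranspose_submatrix,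
      Matrix.submatrix_mul_equiv, Matrix.fromBlocks_conjTranspose, Matrix.fromBlocks_multiply,
      ih₁, ih₂]
    simp

theorem PPCircuit.interpH_mem_unitaryGroup {n : ℕ} (D : PPCircuit n) :
    D.interpH ∈ Matrix.unitaryGroup (Fin n) ℂ := by
  induction D using Quotient.inductionOn
  exact PPTerm.interpH_mem_unitaryGroup _

/-- The block diagonal matrix with blocks `1` and `A`. -/
def Matrix.shiftOne {n : ℕ} (A : Matrix (Fin n) (Fin n) ℂ) : Matrix (Fin (n + 1)) (Fin (n + 1)) ℂ :=
  Matrix.of (Fin.cons (Fin.cons 1 0) fun i => Fin.cons 0 (A i))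

theorem Matrix.shiftOne_injective {n : ℕ} :
    Function.Injective (Matrix.shiftOne (n := n)) := by
  intro A B h
  ext i j
  exact congrFun (congrFun h i.succ) j.succ

/-- Orthogonality of the other rows to the first forces the first column to be a basis vector as
well. -/
theorem Matrix.exists_shiftOne_eq {n : ℕ} {V : Matrix (Fin (n + 1)) (Fin (n + 1)) ℂ}
    (hV : V ∈ Matrix.unitaryGroup (Fin (n + 1)) ℂ)
    (h : ∀ j, V 0 j = (1 : Matrix (Fin (n + 1)) (Fin (n + 1)) ℂ) 0 j) :
    ∃ W ∈ Matrix.unitaryGroup (Fin n) ℂ, Matrix.shiftOne W = V := by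
  rw [Matrix.mem_unitaryGroup_iff] at hV
  have hV' : ∀ i j, ∑ k, V i k * star (V j k) = (1 : Matrix (Fin (n + 1)) (Fin (n + 1)) ℂ) i j := by
    intro i j
    rw [← hV, Matrix.mul_apply]
    rfl
  have h₀ : V 0 0 = 1 := by simp [h]
  have h₁ : ∀ j : Fin n, V 0 j.succ = 0 := fun j => by
    simp [h, (Fin.succ_ne_zero j).symm]
  have h₂ : ∀ i : Fin n, V i.succ 0 = 0 := by
    intro i
    have := hV' i.succ 0
    simpa [Fin.sum_univ_succ, h₀, h₁, Matrix.one_apply] using this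
  refine ⟨V.submatrix Fin.succ Fin.succ, ?_, ?_⟩
  · rw [Matrix.mem_unitaryGroup_iff]
    ext i j
    have := hV' i.succ j.succ
    rw [Fin.sum_univ_succ, h₂, zero_mul, zero_add] at this
    rw [Matrix.mul_apply]
    simpa [Matrix.one_apply] using this
  · ext i j
    cases i using Fin.cases <;> cases j using Fin.cases <;>
      simp [Matrix.shiftOne, h₀, h₁, h₂]

theorem interpH_place_one {n : ℕ} (D : PPCircuit n) :
    (place (n + 1) 1 D).interpH = D.interpH.shiftOne := by
  rw [← cast_place (add_comm 1 n), ← one_tensor, interpH_cast, interpH_tensor]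
  have h₀ : finSumFinEquiv.symm ((finCongr (add_comm 1 n)).symm (0 : Fin (n + 1))) =
      (Sum.inl 0 : Fin 1 ⊕ Fin n) := by
    rw [Equiv.symm_apply_eq]
    ext
    simp
  have h₁ : ∀ i : Fin n, finSumFinEquiv.symm ((finCongr (add_comm 1 n)).symm i.succ) =
      (Sum.inr i : Fin 1 ⊕ Fin n) := by
    intro i
    rw [Equiv.symm_apply_eq]
    ext
    simp [add_comm]
  ext i j
  cases i using Fin.cases <;> cases j using Fin.cases <;>
    simp only [directSum, Matrix.reindex_apply, Matrix.submatrix_apply, h₀, h₁,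
      Matrix.fromBlocks_apply₁₁, Matrix.fromBlocks_apply₁₂, Matrix.fromBlocks_apply₂₁,
      Matrix.fromBlocks_apply₂₂, Matrix.shiftOne, interpH_one] <;> rfl

theorem interpH_place_zero_inl {n m : ℕ} (D : PPCircuit m) (i j : Fin m) :
    (place (m + n) 0 D).interpH (Fin.castAdd n i) (Fin.castAdd n j) = D.interpH i j := by
  rw [← tensor_one, interpH_tensor, directSum, Matrix.reindex_apply, Matrix.submatrix_apply,
    finSumFinEquiv_symm_apply_castAdd, finSumFinEquiv_symm_apply_castAdd,
    Matrix.fromBlocks_apply₁₁]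

theorem interpH_place_zero_inr {n m : ℕ} (D : PPCircuit m) (i : Fin m) (j : Fin n) :
    (place (m + n) 0 D).interpH (Fin.castAdd n i) (Fin.natAdd m j) = 0 := by
  rw [← tensor_one, interpH_tensor, directSum, Matrix.reindex_apply, Matrix.submatrix_apply,
    finSumFinEquiv_symm_apply_castAdd, finSumFinEquiv_symm_apply_natAdd,
    Matrix.fromBlocks_apply₁₂, Matrix.zero_apply]

theorem interpH_place_zero_mul {n m : ℕ} (h : m ≤ n) (D : PPCircuit m)
    (X : Matrix (Fin n) (Fin n) ℂ) (i : Fin m) (k : Fin n) :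
    ((place n 0 D).interpH * X) (Fin.castLE h i) k =
      ∑ j, D.interpH i j * X (Fin.castLE h j) k := by
  obtain ⟨r, rfl⟩ := Nat.exists_eq_add_of_le h
  change ((place (m + r) 0 D).interpH * X) (Fin.castAdd r i) k =
    ∑ j, D.interpH i j * X (Fin.castAdd r j) k
  simp [Matrix.mul_apply, Fin.sum_univ_add, interpH_place_zero_inl, interpH_place_zero_inr]

theorem interpH_phaseStar (φ : ℝ) : (phaseStar φ).interpH = (phase φ).interpH := by
  unfold phaseStar
  split_ifs with h
  · rw [h, (PPRSRule.phaseZero).interpH_eq]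
  · rfl

theorem interpH_bsStar (θ : ℝ) : (bsStar θ).interpH = (bs θ).interpH := by
  unfold bsStar
  split_ifs with h
  · rw [h, (PPRSRule.bsZero).interpH_eq]
  · rfl

theorem interpH_place_phase_mul {n : ℕ} (φ : ℝ) (X : Matrix (Fin (n + 1)) (Fin (n + 1)) ℂ)
    (k : Fin (n + 1)) : ((place (n + 1) 0 (phaseStar φ)).interpH * X) 0 k =
      Complex.exp (Complex.I * φ) * X 0 k := by
  have := interpH_place_zero_mul (Nat.le_add_left 1 n) (phaseStar φ) X 0 k
  rwa [interpH_phaseStar, interpH_phase, Fin.sum_univ_one] at this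

theorem interpH_place_bs_mul {n : ℕ} (θ : ℝ) (X : Matrix (Fin (n + 2)) (Fin (n + 2)) ℂ)
    (k : Fin (n + 2)) : ((place (n + 2) 0 (bsStar θ)).interpH * X) 0 k =
      Complex.cos θ * X 0 k + Complex.I * Complex.sin θ * X 1 k := by
  have := interpH_place_zero_mul (Nat.le_add_left 2 n) (bsStar θ) X 0 k
  rwa [interpH_bsStar, interpH_bs, Fin.sum_univ_two] at this

theorem interpH_place_phase_mul_one {n : ℕ} (φ : ℝ) (X : Matrix (Fin (n + 2)) (Fin (n + 2)) ℂ)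
    (k : Fin (n + 2)) : ((place (n + 2) 0 (phaseStar φ)).interpH * X) 1 k = X 1 k := by
  have := interpH_place_zero_mul (Nat.le_add_left 2 n)
    (tensor (phaseStar φ) (1 : PPCircuit 1)) X 1 k
  rw [place_tensor (by omega), place_one, mul_one, interpH_tensor, directSum_one_by_one,
    interpH_one, Fin.sum_univ_two] at this
  refine Eq.trans this ?_
  simp
  rfl

/-- The conditions on the angles of a diagonal of a triangular normal form. -/
structure DiagonalAngles (α β : ℕ → ℝ) : Prop where
  mem_left : ∀ j, α j ∈ Set.Ico 0 π
  mem_right : ∀ j, β j ∈ Set.Ico 0 π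
  zero_of_lt : ∀ j, α j = 0 → ∀ j', j < j' → α j' = 0
  right_eq_zero : ∀ j, α j = 0 ∨ α j = π / 2 → β j = 0

theorem DiagonalAngles.tail {α β : ℕ → ℝ} (h : DiagonalAngles α β) :
    DiagonalAngles (fun j => α (j + 1)) (fun j => β (j + 1)) :=
  ⟨fun j => h.mem_left _, fun j => h.mem_right _,
    fun j hj j' hj' => h.zero_of_lt _ hj _ (by omega), fun j => h.right_eq_zero _⟩

theorem DiagonalAngles.eq_zero {α β : ℕ → ℝ} (h : DiagonalAngles α β) (h₀ : α 0 = 0) (j : ℕ) :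
    α j = 0 ∧ β j = 0 := by
  have : α j = 0 := by
    rcases Nat.eq_zero_or_pos j with rfl | hj
    · exact h₀
    · exact h.zero_of_lt 0 h₀ j hj
  exact ⟨this, h.right_eq_zero j (.inl this)⟩

theorem DiagonalAngles.zero : DiagonalAngles (fun _ => 0) fun _ => 0 :=
  ⟨fun _ => ⟨le_rfl, pi_pos⟩, fun _ => ⟨le_rfl, pi_pos⟩, fun _ _ _ _ => rfl, fun _ _ => rfl⟩

theorem DiagonalAngles.cons {α β : ℕ → ℝ} (h : DiagonalAngles α β) {a b : ℝ}
    (ha : a ∈ Set.Ioo 0 π) (hb : b ∈ Set.Ico 0 π) (hab : a = π / 2 → b = 0) :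
    DiagonalAngles (fun j => Nat.casesOn j a α) (fun j => Nat.casesOn j b β) := by
  refine ⟨?_, ?_, ?_, ?_⟩
  · rintro (_ | j)
    exacts [Set.Ioo_subset_Ico_self ha, h.mem_left j]
  · rintro (_ | j)
    exacts [hb, h.mem_right j]
  · rintro (_ | j) hj (_ | j') hj'
    · omega
    · exact absurd hj ha.1.ne'
    · omega
    · exact h.zero_of_lt j hj j' (by omega)
  · rintro (_ | j) hj
    · exact hab (hj.resolve_left ha.1.ne')
    · exact h.right_eq_zero j hj

theorem isTriangularNormalForm_iff {n : ℕ} (T : PPCircuit n) : IsTriangularNormalForm T ↔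
    ∃ (α β : ℕ → ℕ → ℝ) (γ : ℕ → ℝ), (∀ i, DiagonalAngles (α i) (β i)) ∧
      (∀ i, γ i ∈ Set.Ico 0 (2 * π)) ∧ T = triangle n α β γ := by
  constructor
  · rintro ⟨α, β, γ, h₁, h₂, h₃, h₄, h₅, h⟩
    exact ⟨α, β, γ, fun i => ⟨h₁ i, h₂ i, h₄ i, h₅ i⟩, h₃, h⟩
  · rintro ⟨α, β, γ, h₁, h₂, h⟩
    exact ⟨α, β, γ, fun i => (h₁ i).mem_left, fun i => (h₁ i).mem_right, h₂,
      fun i => (h₁ i).zero_of_lt, fun i => (h₁ i).right_eq_zero, h⟩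

/-- The first row of the matrix of a diagonal. -/
def diagonalRow : (n : ℕ) → (α β : ℕ → ℝ) → Fin (n + 1) → ℂ
  | 0, _, _ => fun _ => 1
  | n + 1, α, β => Fin.cons (Complex.cos (α 0) * Complex.exp (Complex.I * β 0)) fun j =>
      Complex.I * Complex.sin (α 0) *
        diagonalRow n (fun j => α (j + 1)) (fun j => β (j + 1)) j

/-- The top beam splitter acts last and mixes row `0`, which so far carries only the phase `β 0`,
with row `1`, which is the first row of the shorter diagonal. -/
theorem interpH_diagonal_zero (n : ℕ) (α β : ℕ → ℝ) :
    (diagonal n α β).interpH 0 = diagonalRow n α β := by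
  induction n generalizing α β with
  | zero =>
    ext j
    obtain rfl := Fin.fin_one_eq_zero j
    rfl
  | succ n ih =>
    ext j
    rw [diagonal_succ, interpH_mul, interpH_mul, Matrix.mul_assoc, interpH_place_bs_mul,
      interpH_place_phase_mul, interpH_place_phase_mul_one, interpH_place_one]
    rw [show (1 : Fin (n + 2)) = Fin.succ 0 from rfl]
    cases j using Fin.cases with
    | zero => simp [Matrix.shiftOne, diagonalRow, -Fin.succ_zero_eq_one]
    | succ j =>
      rw [diagonalRow, Fin.cons_succ, ← ih]
      simp [Matrix.shiftOne, -Fin.succ_zero_eq_one]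

theorem shiftOne_mul_zero {n : ℕ} (A : Matrix (Fin n) (Fin n) ℂ)
    (X : Matrix (Fin (n + 1)) (Fin (n + 1)) ℂ) : (A.shiftOne * X) 0 = X 0 := by
  ext j
  simp [Matrix.mul_apply, Fin.sum_univ_succ, Matrix.shiftOne]

theorem interpH_phase_diagonal_zero (n : ℕ) (α β : ℕ → ℝ) (γ : ℝ) (k : Fin (n + 1)) :
    (place (n + 1) 0 (phaseStar γ) * diagonal n α β).interpH 0 k =
      Complex.exp (Complex.I * γ) * diagonalRow n α β k := by
  rw [interpH_mul, interpH_place_phase_mul, interpH_diagonal_zero]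

/-! ### Uniqueness of triangles -/

theorem diagonal_congr (n : ℕ) {α β α' β' : ℕ → ℝ} (h : ∀ j < n, α j = α' j ∧ β j = β' j) :
    diagonal n α β = diagonal n α' β' := by
  induction n generalizing α β α' β' with
  | zero => rfl
  | succ n ih =>
    rw [diagonal_succ, diagonal_succ, (h 0 (by omega)).1, (h 0 (by omega)).2,
      ih fun j hj => h (j + 1) (by omega)]

theorem sin_nonneg_of_mem_Ico {x : ℝ} (h : x ∈ Set.Ico 0 π) : 0 ≤ Real.sin x :=
  Real.sin_nonneg_of_nonneg_of_le_pi h.1 h.2.le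

theorem eq_zero_of_sin_eq_zero {x : ℝ} (h : x ∈ Set.Ico 0 π) (hs : Real.sin x = 0) : x = 0 := by
  by_contra hx
  exact (Real.sin_pos_of_pos_of_lt_pi (lt_of_le_of_ne h.1 (Ne.symm hx)) h.2).ne' hs

/-- Polar coordinates with a signed radius `cos a` and an argument in a half-turn: they are unique
once the argument is fixed at radius zero, and cosine is injective on `[0, π]`. -/
theorem eq_of_cos_mul_exp_eq {a b a' b' : ℝ} (ha : a ∈ Set.Ico 0 π) (hb : b ∈ Set.Ico 0 π)
    (ha' : a' ∈ Set.Ico 0 π) (hb' : b' ∈ Set.Ico 0 π) (hab : a = π / 2 → b = 0)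
    (hab' : a' = π / 2 → b' = 0)
    (h : Complex.cos a * Complex.exp (Complex.I * b) =
      Complex.cos a' * Complex.exp (Complex.I * b')) : a = a' ∧ b = b' := by
  have inj := Real.injOn_cos
  have hI : ∀ {x : ℝ}, x ∈ Set.Ico 0 π → x ∈ Set.Icc 0 π := fun h => Set.Ico_subset_Icc_self h
  have hπ := pi_pos
  have hp : π / 2 ∈ Set.Icc 0 π := ⟨by linarith, by linarith⟩
  have hn : |Real.cos a| = |Real.cos a'| := by
    have := congrArg norm h
    rwa [norm_mul, norm_mul, norm_exp_I_mul, norm_exp_I_mul, mul_one, mul_one,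
      ← Complex.ofReal_cos, ← Complex.ofReal_cos, Complex.norm_real, Complex.norm_real] at this
  by_cases hc : Real.cos a = 0
  · have hc' : Real.cos a' = 0 := by rwa [hc, abs_zero, eq_comm, abs_eq_zero] at hn
    have e : a = π / 2 := inj (hI ha) hp (hc.trans Real.cos_pi_div_two.symm)
    have e' : a' = π / 2 := inj (hI ha') hp (hc'.trans Real.cos_pi_div_two.symm)
    exact ⟨e.trans e'.symm, (hab e).trans (hab' e').symm⟩
  -- The right side is real, so `sin (b - b') = 0`, while `|b - b'| < π`.
  · have hd : Complex.exp (Complex.I * (b - b' : ℝ)) * Real.cos a = Real.cos a' := by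
      have e := Complex.exp_ne_zero (Complex.I * b')
      rw [Complex.ofReal_sub, mul_sub, Complex.exp_sub, div_mul_eq_mul_div, div_eq_iff e]
      push_cast
      rw [← h, mul_comm]
    have him : Real.sin (b - b') * Real.cos a = 0 := by
      have := congrArg Complex.im hd
      rwa [mul_comm Complex.I, Complex.im_mul_ofReal, Complex.exp_ofReal_mul_I_im,
        Complex.ofReal_im] at this
    have hbb : b - b' = 0 := by
      refine (Real.sin_eq_zero_iff_of_lt_of_lt ?_ ?_).1 ((mul_eq_zero.1 him).resolve_right hc)
      · linarith [hb.1, hb'.2]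
      · linarith [hb.2, hb'.1]
    refine ⟨inj (hI ha) (hI ha') ?_, sub_eq_zero.1 hbb⟩
    rw [hbb, Complex.ofReal_zero, mul_zero, Complex.exp_zero, one_mul] at hd
    exact_mod_cast hd

/-- The modulus of the first entry gives `sin (α 0)`, which is nonnegative. If it is nonzero it
cancels from the tail, and the induction finds the global phase `z` there first; only then can the
first entry be divided by `z` to give `α 0` and `β 0`. -/
theorem diagonalRow_unique (n : ℕ) {α β α' β' : ℕ → ℝ} (h : DiagonalAngles α β)
    (h' : DiagonalAngles α' β') {z z' : ℂ} (hz : ‖z‖ = 1) (hz' : ‖z'‖ = 1)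
    (hrow : ∀ k, z * diagonalRow n α β k = z' * diagonalRow n α' β' k) :
    z = z' ∧ ∀ j < n, α j = α' j ∧ β j = β' j := by
  induction n generalizing α β α' β' with
  | zero => exact ⟨by simpa [diagonalRow] using hrow 0, fun j hj => absurd hj (by omega)⟩
  | succ n ih =>
    have hz₀ : z ≠ 0 := fun h => by simp [h] at hz
    have e₀ : z * (Complex.cos (α 0) * Complex.exp (Complex.I * β 0)) =
        z' * (Complex.cos (α' 0) * Complex.exp (Complex.I * β' 0)) := hrow 0
    have e₁ : ∀ k, z * (Complex.I * Complex.sin (α 0) *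
          diagonalRow n (fun j => α (j + 1)) (fun j => β (j + 1)) k) =
        z' * (Complex.I * Complex.sin (α' 0) *
          diagonalRow n (fun j => α' (j + 1)) (fun j => β' (j + 1)) k) := fun k => hrow k.succ
    have hn : |Real.cos (α 0)| = |Real.cos (α' 0)| := by
      have := congrArg norm e₀
      rwa [norm_mul, norm_mul, norm_mul, norm_mul, hz, hz', norm_exp_I_mul, norm_exp_I_mul,
        mul_one, mul_one, one_mul, one_mul, ← Complex.ofReal_cos, ← Complex.ofReal_cos,
        Complex.norm_real, Complex.norm_real] at this
    have hs : Real.sin (α 0) = Real.sin (α' 0) := by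
      rw [← abs_of_nonneg (sin_nonneg_of_mem_Ico (h.mem_left 0)),
        ← abs_of_nonneg (sin_nonneg_of_mem_Ico (h'.mem_left 0)), ← sq_eq_sq_iff_abs_eq_abs,
        Real.sin_sq, Real.sin_sq, sub_right_inj, sq_eq_sq_iff_abs_eq_abs, hn]
    by_cases hs₀ : Real.sin (α 0) = 0
    -- The tail entries vanish and carry no information, but the angle conventions make the whole
    -- diagonal zero.
    · have ha := h.eq_zero (eq_zero_of_sin_eq_zero (h.mem_left 0) hs₀)
      have ha' := h'.eq_zero (eq_zero_of_sin_eq_zero (h'.mem_left 0) (hs ▸ hs₀))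
      refine ⟨?_, fun j _ => ⟨(ha j).1.trans (ha' j).1.symm, (ha j).2.trans (ha' j).2.symm⟩⟩
      simpa [ha, ha'] using e₀
    · obtain ⟨rfl, ht⟩ := ih h.tail h'.tail fun k => by
        have := e₁ k
        rw [← Complex.ofReal_sin, ← Complex.ofReal_sin, ← hs] at this
        have hne : Complex.I * (Real.sin (α 0) : ℂ) ≠ 0 :=
          mul_ne_zero Complex.I_ne_zero (by exact_mod_cast hs₀)
        refine mul_left_cancel₀ hne ?_
        linear_combination this
      refine ⟨rfl, ?_⟩
      rintro (_ | j) hj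
      · exact eq_of_cos_mul_exp_eq (h.mem_left 0) (h.mem_right 0) (h'.mem_left 0)
          (h'.mem_right 0) (fun e => h.right_eq_zero 0 (.inr e))
          (fun e => h'.right_eq_zero 0 (.inr e)) (mul_left_cancel₀ hz₀ e₀)
      · exact ht j (by omega)

theorem eq_of_exp_I_mul_eq {x y : ℝ} (hx : x ∈ Set.Ico 0 (2 * π)) (hy : y ∈ Set.Ico 0 (2 * π))
    (h : Complex.exp (Complex.I * x) = Complex.exp (Complex.I * y)) : x = y := by
  obtain ⟨k, hk⟩ := Complex.exp_eq_exp_iff_exists_int.1 h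
  have hk' : x = y + k * (2 * π) := by
    have : Complex.I * (x : ℂ) = Complex.I * ((y + k * (2 * π) : ℝ) : ℂ) := by
      rw [hk]
      push_cast
      ring
    exact_mod_cast mul_left_cancel₀ Complex.I_ne_zero this
  have hπ := pi_pos
  have h₁ : (k : ℝ) < 1 := by
    by_contra! h'
    nlinarith [hx.2, hy.1]
  have h₂ : (-1 : ℝ) < k := by
    by_contra! h'
    nlinarith [hx.1, hy.2]
  obtain rfl : k = 0 := by
    have h₁ : k < 1 := by exact_mod_cast h₁
    have h₂ : -1 < k := by exact_mod_cast h₂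
    omega
  simpa using hk'

/-- The smaller triangle does not touch the first row, so that row determines the first diagonal and
its phase. Their product is unitary and cancels on the right. -/
theorem triangle_unique (n : ℕ) {α β α' β' : ℕ → ℕ → ℝ} {γ γ' : ℕ → ℝ}
    (h : ∀ i, DiagonalAngles (α i) (β i)) (h' : ∀ i, DiagonalAngles (α' i) (β' i))
    (hγ : ∀ i, γ i ∈ Set.Ico 0 (2 * π)) (hγ' : ∀ i, γ' i ∈ Set.Ico 0 (2 * π))
    (heq : (triangle n α β γ).interpH = (triangle n α' β' γ').interpH) :
    triangle n α β γ = triangle n α' β' γ' := by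
  induction n generalizing α β α' β' γ γ' with
  | zero => rfl
  | succ n ih =>
    rw [triangle_succ, triangle_succ, mul_assoc, mul_assoc] at heq ⊢
    have hrow : ∀ k, Complex.exp (Complex.I * γ 0) * diagonalRow n (α 0) (β 0) k =
        Complex.exp (Complex.I * γ' 0) * diagonalRow n (α' 0) (β' 0) k := by
      intro k
      rw [← interpH_phase_diagonal_zero, ← interpH_phase_diagonal_zero]
      rw [interpH_mul, interpH_mul (place (n + 1) 1 _), interpH_place_one,
        interpH_place_one] at heq
      have := congrFun heq 0
      rw [shiftOne_mul_zero, shiftOne_mul_zero] at this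
      exact congrFun this k
    obtain ⟨e, hd⟩ := diagonalRow_unique n (h 0) (h' 0) (norm_exp_I_mul _) (norm_exp_I_mul _) hrow
    rw [eq_of_exp_I_mul_eq (hγ 0) (hγ' 0) e, diagonal_congr n hd] at heq ⊢
    rw [interpH_mul, interpH_mul (place (n + 1) 1 _)] at heq
    have hX := Matrix.mem_unitaryGroup_iff.1
      (PPCircuit.interpH_mem_unitaryGroup (place (n + 1) 0 (phaseStar (γ' 0)) *
        diagonal n (α' 0) (β' 0)))
    have heq' := congrArg (· * star (place (n + 1) 0 (phaseStar (γ' 0)) *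
      diagonal n (α' 0) (β' 0)).interpH) heq
    simp only [Matrix.mul_assoc, hX, Matrix.mul_one] at heq'
    rw [interpH_place_one, interpH_place_one] at heq'
    rw [ih (fun i => h (i + 1)) (fun i => h' (i + 1)) (fun i => hγ (i + 1))
      (fun i => hγ' (i + 1)) (Matrix.shiftOne_injective heq')]

/-! ### Every unitary matrix is the semantics of a triangle -/

/-- Bring the argument of `w` into `[0, π)`, changing the sign of the radius when it moves by `π`,
and take `a` to be the arccosine of the signed radius. -/
theorem exists_cos_mul_exp_eq {w : ℂ} (hw : ‖w‖ < 1) : ∃ a ∈ Set.Ioo 0 π, ∃ b ∈ Set.Ico 0 π,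
    (a = π / 2 → b = 0) ∧ w = Complex.cos a * Complex.exp (Complex.I * b) ∧
    Real.sin a = √(1 - ‖w‖ ^ 2) := by
  have hπ := pi_pos
  have key : ∀ r b : ℝ, |r| = ‖w‖ → b ∈ Set.Ico 0 π → (r = 0 → b = 0) →
      w = r * Complex.exp (Complex.I * b) → ∃ a ∈ Set.Ioo 0 π, ∃ b ∈ Set.Ico 0 π,
      (a = π / 2 → b = 0) ∧ w = Complex.cos a * Complex.exp (Complex.I * b) ∧
      Real.sin a = √(1 - ‖w‖ ^ 2) := by
    intro r b hr hb h₀ h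
    have hr₁ := abs_lt.1 (hr.trans_lt hw)
    have hc := Real.cos_arccos hr₁.1.le hr₁.2.le
    refine ⟨Real.arccos r, ⟨Real.arccos_pos.2 hr₁.2, Real.arccos_lt_pi.2 hr₁.1⟩, b, hb,
      fun e => h₀ ?_, ?_, ?_⟩
    · rw [← hc, e, Real.cos_pi_div_two]
    · rw [← Complex.ofReal_cos, hc, h]
    · rw [Real.sin_arccos, ← hr, sq_abs]
  by_cases hw₀ : w = 0
  · exact key 0 0 (by simp [hw₀]) ⟨le_rfl, hπ⟩ (fun _ => rfl) (by simp [hw₀])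
  have hpol : w = ‖w‖ * Complex.exp (Complex.I * Complex.arg w) := by
    rw [mul_comm Complex.I, Complex.norm_mul_exp_arg_mul_I]
  have hne : ‖w‖ ≠ 0 := by simpa using hw₀
  have hshift : ∀ b : ℝ, Complex.exp (Complex.I * (b - π : ℝ)) = -Complex.exp (Complex.I * b) := by
    intro b
    rw [Complex.ofReal_sub, mul_sub, Complex.exp_sub, exp_I_pi, div_neg, div_one]
  rcases lt_or_ge (Complex.arg w) 0 with h | h
  · refine key (-‖w‖) (Complex.arg w + π) (by simp) ⟨by linarith [Complex.neg_pi_lt_arg w],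
      by linarith⟩ (fun e => absurd (neg_eq_zero.1 e) hne) ?_
    have := hshift (Complex.arg w + π)
    rw [add_sub_cancel_right] at this
    rw [this] at hpol
    rw [Complex.ofReal_neg]
    linear_combination hpol
  · rcases (Complex.arg_le_pi w).lt_or_eq with h' | h'
    · exact key ‖w‖ (Complex.arg w) (by simp) ⟨h, h'⟩ (fun e => absurd e hne) hpol
    · refine key (-‖w‖) 0 (by simp) ⟨le_rfl, hπ⟩ (fun _ => rfl) ?_
      rw [h', exp_I_pi] at hpol
      rw [Complex.ofReal_zero, mul_zero, Complex.exp_zero]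
      push_cast
      linear_combination hpol

theorem exists_exp_I_mul_eq {z : ℂ} (hz : ‖z‖ = 1) : ∃ γ : ℝ, z = Complex.exp (Complex.I * γ) :=
  ⟨Complex.arg z, by
    have := Complex.norm_mul_exp_arg_mul_I z
    rw [hz, Complex.ofReal_one, one_mul] at this
    rw [mul_comm, this]⟩

/-- Spherical coordinates for unit vectors, built from the bottom entry upwards. -/
theorem exists_diagonalRow (n : ℕ) {v : Fin (n + 1) → ℂ} (hv : ∑ k, ‖v k‖ ^ 2 = 1) :
    ∃ (α β : ℕ → ℝ) (γ : ℝ), DiagonalAngles α β ∧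
      ∀ k, v k = Complex.exp (Complex.I * γ) * diagonalRow n α β k := by
  induction n with
  | zero =>
    rw [Fin.sum_univ_one, pow_eq_one_iff_of_nonneg (norm_nonneg _) two_ne_zero] at hv
    obtain ⟨γ, hγ⟩ := exists_exp_I_mul_eq hv
    refine ⟨_, _, γ, .zero, fun k => ?_⟩
    obtain rfl := Fin.fin_one_eq_zero k
    simpa [diagonalRow] using hγ
  | succ n ih =>
    rw [Fin.sum_univ_succ] at hv
    set s := ∑ k : Fin (n + 1), ‖v k.succ‖ ^ 2 with hs
    have hs₀ : 0 ≤ s := Finset.sum_nonneg fun k _ => sq_nonneg _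
    rcases hs₀.eq_or_lt with hs₀ | hs₀
    · have h₁ : ∀ k : Fin (n + 1), v k.succ = 0 := fun k => by
        have := (Finset.sum_eq_zero_iff_of_nonneg fun k _ => sq_nonneg _).1
          (hs.symm.trans hs₀.symm) k (Finset.mem_univ k)
        simpa using this
      rw [← hs₀, add_zero, pow_eq_one_iff_of_nonneg (norm_nonneg _) two_ne_zero] at hv
      obtain ⟨γ, hγ⟩ := exists_exp_I_mul_eq hv
      refine ⟨_, _, γ, .zero, fun k => ?_⟩
      cases k using Fin.cases with
      | zero => simpa [diagonalRow] using hγ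
      | succ k => simp [diagonalRow, h₁]
    · have hr : √s ≠ 0 := (Real.sqrt_pos.2 hs₀).ne'
      have hr' : (√s : ℂ) ≠ 0 := by exact_mod_cast hr
      -- The divisor normalises the tail and is the factor `I * sin a` that the new beam splitter
      -- will restore.
      obtain ⟨α, β, γ, hαβ, h⟩ := ih (v := fun k => v k.succ / (Complex.I * √s)) (by
        simp only [norm_div, norm_mul, Complex.norm_I, one_mul, Complex.norm_real, div_pow,
          Real.norm_eq_abs, sq_abs, Real.sq_sqrt hs₀.le]
        rw [← Finset.sum_div, ← hs, div_self hs₀.ne'])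
      -- The tail already fixes the global phase `γ`, so it is removed from the first entry.
      have hw : ‖v 0 * Complex.exp (Complex.I * (-γ : ℝ))‖ = ‖v 0‖ := by
        rw [norm_mul, norm_exp_I_mul, mul_one]
      obtain ⟨a, ha, b, hb, hab, hw₁, hw₂⟩ :=
        exists_cos_mul_exp_eq (w := v 0 * Complex.exp (Complex.I * (-γ : ℝ))) (by
          rw [hw]
          nlinarith [norm_nonneg (v 0)])
      rw [hw, show 1 - ‖v 0‖ ^ 2 = s by linarith] at hw₂
      refine ⟨_, _, γ, hαβ.cons ha hb hab, fun k => ?_⟩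
      cases k using Fin.cases with
      | zero =>
        rw [diagonalRow, Fin.cons_zero]
        change v 0 = _ * (Complex.cos a * Complex.exp (Complex.I * b))
        rw [← hw₁, mul_comm, mul_assoc, ← Complex.exp_add]
        simp
      | succ k =>
        have := h k
        rw [div_eq_iff (mul_ne_zero Complex.I_ne_zero hr')] at this
        rw [diagonalRow, Fin.cons_succ, this]
        change _ = _ * (Complex.I * Complex.sin a * diagonalRow n α β k)
        rw [← Complex.ofReal_sin, hw₂]
        ring

/-- Realise the first row of `U` by a phase and a diagonal with matrix `X`; then `U * star X` fixes
the first mode, and induction applies to its remaining block. -/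
theorem exists_triangle (n : ℕ) {U : Matrix (Fin n) (Fin n) ℂ}
    (hU : U ∈ Matrix.unitaryGroup (Fin n) ℂ) :
    ∃ (α β : ℕ → ℕ → ℝ) (γ : ℕ → ℝ), (∀ i, DiagonalAngles (α i) (β i)) ∧
      (∀ i, γ i ∈ Set.Ico 0 (2 * π)) ∧ (triangle n α β γ).interpH = U := by
  induction n with
  | zero =>
    exact ⟨fun _ _ => 0, fun _ _ => 0, fun _ => 0, fun _ => .zero,
      fun _ => ⟨le_rfl, two_pi_pos⟩, Subsingleton.elim _ _⟩
  | succ n ih =>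
    obtain ⟨α₀, β₀, γ, h₀, hrow⟩ := exists_diagonalRow n (v := U 0) (by
      have h := congrFun (congrFun (Matrix.mem_unitaryGroup_iff.1 hU) 0) 0
      rw [Matrix.mul_apply, Matrix.one_apply_eq] at h
      have h' : ((∑ k, ‖U 0 k‖ ^ 2 : ℝ) : ℂ) = 1 := by
        rw [← h]
        push_cast
        exact Finset.sum_congr rfl fun k _ => (Complex.mul_conj' _).symm
      exact_mod_cast h')
    set γ₀ := toIcoMod two_pi_pos 0 γ with hγ₀
    set X := (place (n + 1) 0 (phaseStar γ₀) * diagonal n α₀ β₀).interpH with hX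
    have hXU : X ∈ Matrix.unitaryGroup (Fin (n + 1)) ℂ := PPCircuit.interpH_mem_unitaryGroup _
    have hX₀ : ∀ k, X 0 k = U 0 k := fun k => by
      rw [hX, interpH_phase_diagonal_zero, hγ₀, exp_I_mul_toIcoMod, hrow]
    obtain ⟨W, hW, hWV⟩ := Matrix.exists_shiftOne_eq (V := U * star X)
      (mul_mem hU (Unitary.star_mem hXU)) fun j => by
        rw [← Matrix.mem_unitaryGroup_iff.1 hXU, Matrix.mul_apply, Matrix.mul_apply]
        simp only [hX₀]
    obtain ⟨α, β, γ', h₁, h₂, h₃⟩ := ih hW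
    refine ⟨fun i => Nat.casesOn i α₀ α, fun i => Nat.casesOn i β₀ β,
      fun i => Nat.casesOn i γ₀ γ', ?_, ?_, ?_⟩
    · rintro (_ | i)
      exacts [h₀, h₁ i]
    · rintro (_ | i)
      exacts [toIcoMod_two_pi_mem γ, h₂ i]
    · rw [triangle_succ, mul_assoc, interpH_mul, interpH_place_one]
      change Matrix.shiftOne (triangle n α β γ').interpH * X = U
      rw [h₃, hWV, Matrix.mul_assoc, Matrix.mem_unitaryGroup_iff'.1 hXU, Matrix.mul_one]

/-! ### The right-hand sides of the Euler rules exist -/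

theorem interpH_place_phaseStar (n p : ℕ) (φ : ℝ) :
    (place n p (phaseStar φ)).interpH = (place n p (phase φ)).interpH :=
  interpH_place_congr (interpH_phaseStar φ)

theorem interpH_place_bsStar (n p : ℕ) (θ : ℝ) :
    (place n p (bsStar θ)).interpH = (place n p (bs θ)).interpH :=
  interpH_place_congr (interpH_bsStar θ)

theorem triangle_zero (α β : ℕ → ℕ → ℝ) (γ : ℕ → ℝ) : triangle 0 α β γ = 1 := rfl

theorem diagonal_zero (α β : ℕ → ℝ) : diagonal 0 α β = 1 := rfl

theorem diagonal_one (α β : ℕ → ℝ) :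
    diagonal 1 α β = place 2 0 (bsStar (α 0)) * place 2 0 (phaseStar (β 0)) := by
  rw [diagonal_succ, diagonal_zero, place_one, mul_one]

theorem triangle_one (α β : ℕ → ℕ → ℝ) (γ : ℕ → ℝ) : triangle 1 α β γ = phaseStar (γ 0) := by
  rw [triangle_succ, triangle_zero, diagonal_zero, place_one, place_self, mul_one, one_mul]

theorem triangle_two (α β : ℕ → ℕ → ℝ) (γ : ℕ → ℝ) : triangle 2 α β γ =
    place 2 1 (phaseStar (γ 1)) * place 2 0 (phaseStar (γ 0)) *
      (place 2 0 (bsStar (α 0 0)) * place 2 0 (phaseStar (β 0 0))) := by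
  rw [triangle_succ, triangle_one, diagonal_one]

/-- Collecting the three output phases on the left gives the shape of the right-hand side of
`slide`. -/
theorem triangle_three (α β : ℕ → ℕ → ℝ) (γ : ℕ → ℝ) : triangle 3 α β γ =
    place 3 0 (phaseStar (γ 0)) * place 3 1 (phaseStar (γ 1)) * place 3 2 (phaseStar (γ 2)) *
      ((place 3 1 (bsStar (α 1 0)) * place 3 1 (phaseStar (β 1 0))) *
      ((place 3 0 (bsStar (α 0 0)) * place 3 0 (phaseStar (β 0 0))) *
      (place 3 1 (bsStar (α 0 1)) * place 3 1 (phaseStar (β 0 1))))) := by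
  rw [triangle_succ, diagonal_succ, ← place_comm (p := 0) (q := 1) (by omega) (by omega),
    triangle_two, diagonal_one]
  simp only [place_mul]
  simp only [place_place (n := 3) (p := 1) (m := 2) (q := 0) (k := 2) (by omega) (by omega),
    place_place (n := 3) (p := 1) (m := 2) (q := 0) (k := 1) (by omega) (by omega),
    place_place (n := 3) (p := 1) (m := 2) (q := 1) (k := 1) (by omega) (by omega)]
  rw [← place_comm (n := 3) (p := 1 + 0) (q := 1 + 1) (by omega) (by omega)]
  simp only [mul_assoc]

theorem onTop_eq (D : PPCircuit 2) : onTop D = place 3 0 D := tensor_one D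

theorem onBottom_eq (D : PPCircuit 2) : onBottom D = place 3 1 D := one_tensor D

theorem parallel3_eq (D₀ D₁ D₂ : PPCircuit 1) :
    parallel3 D₀ D₁ D₂ = place 3 0 D₀ * place 3 1 D₁ * place 3 2 D₂ := by
  rw [parallel3, ← place_self (D₀ ⊕ₚ D₁ ⊕ₚ D₂), place_tensor (by omega), place_tensor (by omega)]

/-- The rule takes suitable angles as data; a triangle with the unitary matrix of the left-hand side
supplies them. -/
theorem exists_rule_euler {θ₁ θ₂ : ℝ} {φ₁ : Option ℝ} (hθ₁ : θ₁ ∈ Set.Ioo 0 π)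
    (hθ₂ : θ₂ ∈ Set.Ioo 0 π) (hφ₁ : ∀ φ ∈ φ₁, φ ∈ Set.Ioo 0 (2 * π)) :
    ∃ R, PPRSRule (bs θ₂ ∘ₚ (phaseOpt φ₁ ⊕ₚ wires 1) ∘ₚ bs θ₁) R := by
  obtain ⟨α, β, γ, h, hγ, hU⟩ := exists_triangle 2
    (bs θ₂ ∘ₚ (phaseOpt φ₁ ⊕ₚ wires 1) ∘ₚ bs θ₁).interpH_mem_unitaryGroup
  refine ⟨_, PPRSRule.euler θ₁ θ₂ φ₁ (α 0 0) (β 0 0) (γ 0) (γ 1) hθ₁ hθ₂ hφ₁ ((h 0).mem_left 0)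
    ((h 0).mem_right 0) (hγ 0) (hγ 1) ((h 0).right_eq_zero 0) _ _ rfl rfl ?_⟩
  rw [← hU, triangle_two, ← place_comm (p := 0) (q := 1) (by omega) (by omega)]
  simp only [comp_eq_mul, wires_eq_one, tensor_eq, place_one, mul_one, interpH_mul,
    interpH_place_phaseStar, interpH_place_bsStar]
  rw [place_self (bs (α 0 0)), Matrix.mul_assoc]

theorem exists_rule_slide {θ₁ θ₂ θ₃ : ℝ} {φ₁ φ₂ : Option ℝ} (hθ₁ : θ₁ ∈ Set.Ioo 0 π)
    (hθ₂ : θ₂ ∈ Set.Ioo 0 π) (hθ₃ : θ₃ ∈ Set.Ioo 0 π)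
    (hφ₁ : ∀ φ ∈ φ₁, φ ∈ Set.Ioo 0 (2 * π)) (hφ₂ : ∀ φ ∈ φ₂, φ ∈ Set.Ioo 0 (2 * π)) :
    ∃ R, PPRSRule (onTop (bs θ₃) ∘ₚ onBottom (bs θ₂) ∘ₚ
        parallel3 (phaseOpt φ₂) (phaseOpt φ₁) (wires 1) ∘ₚ onTop (bs θ₁)) R := by
  obtain ⟨α, β, γ, h, hγ, hU⟩ := exists_triangle 3
    (onTop (bs θ₃) ∘ₚ onBottom (bs θ₂) ∘ₚ
        parallel3 (phaseOpt φ₂) (phaseOpt φ₁) (wires 1) ∘ₚ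
        onTop (bs θ₁)).interpH_mem_unitaryGroup
  -- A diagonal is traversed bottom to top, so the first beam splitter met has index `0 1`.
  refine ⟨_, PPRSRule.slide θ₁ θ₂ θ₃ φ₁ φ₂ (α 0 1) (α 0 0) (α 1 0) (β 0 1) (β 0 0) (β 1 0)
    (γ 0) (γ 1) (γ 2) hθ₁ hθ₂ hθ₃ hφ₁ hφ₂ ((h 0).mem_left 1) ((h 0).mem_left 0)
    ((h 1).mem_left 0) ((h 0).mem_right 1) ((h 0).mem_right 0) ((h 1).mem_right 0)
    (hγ 0) (hγ 1) (hγ 2) ((h 0).right_eq_zero 1) ((h 0).right_eq_zero 0) ((h 1).right_eq_zero 0)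
    (fun h₀ => (h 0).zero_of_lt 0 h₀ 1 one_pos) _ _ rfl rfl ?_⟩
  rw [← hU, triangle_three, onBottom_eq, onBottom_eq, onTop_eq, parallel3_eq]
  simp only [comp_eq_mul, wires_eq_one, tensor_one, place_mul,
    place_place (n := 3) (p := 1) (m := 1 + 1) (q := 0) (k := 1) (by omega) (by omega),
    place_place (n := 3) (p := 0) (m := 1 + 1) (q := 0) (k := 1) (by omega) (by omega),
    interpH_mul, interpH_place_phaseStar, interpH_place_bsStar]

/-! ### Irreducible circuits are triangular -/

theorem PPRSIrreducible.phase_mem {φ : ℝ} (h : PPRSIrreducible (phase φ)) :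
    φ ∈ Set.Ioo 0 (2 * π) := by
  have h₁ : φ ∈ Set.Ico 0 (2 * π) := by
    by_contra h'
    exact h.not_rule (.phaseMod φ h')
  refine ⟨lt_of_le_of_ne h₁.1 ?_, h₁.2⟩
  rintro rfl
  exact h.not_rule .phaseZero

theorem PPRSIrreducible.bs_mem {θ : ℝ} (h : PPRSIrreducible (bs θ)) : θ ∈ Set.Ioo 0 π := by
  have h₁ : θ ∈ Set.Ico 0 (2 * π) := by
    by_contra h'
    exact h.not_rule (.bsMod θ h')
  refine ⟨lt_of_le_of_ne h₁.1 ?_, ?_⟩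
  · rintro rfl
    exact h.not_rule .bsZero
  · by_contra! h'
    exact h.not_rule (.bsSubPi θ ⟨h', h₁.2⟩)

theorem phaseStar_zero : phaseStar 0 = 1 := if_pos rfl
theorem phaseStar_of_ne {φ : ℝ} (h : φ ≠ 0) : phaseStar φ = phase φ := if_neg h
theorem bsStar_zero : bsStar 0 = 1 := if_pos rfl
theorem bsStar_of_ne {θ : ℝ} (h : θ ≠ 0) : bsStar θ = bs θ := if_neg h

theorem exists_phaseOpt_eq {φ : ℝ} (h : φ ∈ Set.Ico 0 (2 * π)) :
    ∃ o, phaseStar φ = phaseOpt o ∧ ∀ ψ ∈ o, ψ ∈ Set.Ioo 0 (2 * π) := by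
  by_cases h₀ : φ = 0
  · exact ⟨none, by rw [h₀, phaseStar_zero]; rfl, by simp⟩
  · exact ⟨some φ, phaseStar_of_ne h₀, by simpa using ⟨lt_of_le_of_ne h.1 (Ne.symm h₀), h.2⟩⟩

theorem diagonal_zero_angles (n : ℕ) : diagonal n (fun _ => 0) (fun _ => 0) = 1 := by
  induction n with
  | zero => rfl
  | succ n ih => rw [diagonal_succ, ih, bsStar_zero, phaseStar_zero, place_one, place_one,
      place_one, one_mul, one_mul]

theorem DiagonalAngles.diagonal_eq_one {α β : ℕ → ℝ} (h : DiagonalAngles α β) (h₀ : α 0 = 0)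
    (n : ℕ) : diagonal n α β = 1 := by
  rw [diagonal_congr n fun j _ => h.eq_zero h₀ j, diagonal_zero_angles]

theorem IsTriangularNormalForm.cons {n : ℕ} {T : PPCircuit n} (hT : IsTriangularNormalForm T)
    {α β : ℕ → ℝ} (h : DiagonalAngles α β) {γ : ℝ} (hγ : γ ∈ Set.Ico 0 (2 * π)) :
    IsTriangularNormalForm
      (place (n + 1) 1 T * place (n + 1) 0 (phaseStar γ) * diagonal n α β) := by
  rw [isTriangularNormalForm_iff] at hT ⊢
  obtain ⟨α', β', γ', h₁, h₂, rfl⟩ := hT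
  refine ⟨fun i => Nat.casesOn i α α', fun i => Nat.casesOn i β β',
    fun i => Nat.casesOn i γ γ', ?_, ?_, ?_⟩
  · rintro (_ | i)
    exacts [h, h₁ i]
  · rintro (_ | i)
    exacts [hγ, h₂ i]
  · exact (triangle_succ n (fun i => Nat.casesOn i α α') (fun i => Nat.casesOn i β β')
      fun i => Nat.casesOn i γ γ').symm

theorem IsTriangularNormalForm.exists_eq {n : ℕ} {T : PPCircuit (n + 1)}
    (hT : IsTriangularNormalForm T) : ∃ (T' : PPCircuit n) (α β : ℕ → ℝ) (γ : ℝ),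
      IsTriangularNormalForm T' ∧ DiagonalAngles α β ∧ γ ∈ Set.Ico 0 (2 * π) ∧
      T = place (n + 1) 1 T' * place (n + 1) 0 (phaseStar γ) * diagonal n α β := by
  obtain ⟨α, β, γ, h₁, h₂, rfl⟩ := (isTriangularNormalForm_iff T).1 hT
  exact ⟨_, α 0, β 0, γ 0, (isTriangularNormalForm_iff _).2
    ⟨_, _, _, fun i => h₁ (i + 1), fun i => h₂ (i + 1), rfl⟩, h₁ 0, h₂ 0, triangle_succ _ _ _ _⟩

theorem isTriangularNormalForm_one (n : ℕ) : IsTriangularNormalForm (1 : PPCircuit n) := by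
  induction n with
  | zero =>
    exact (isTriangularNormalForm_iff _).2 ⟨fun _ _ => 0, fun _ _ => 0, fun _ => 0,
      fun _ => .zero, fun _ => ⟨le_rfl, two_pi_pos⟩, rfl⟩
  | succ n ih =>
    have := ih.cons .zero (γ := 0) ⟨le_rfl, two_pi_pos⟩
    rwa [diagonal_zero_angles, phaseStar_zero, place_one, place_one, one_mul, one_mul] at this

theorem place_comm_assoc {n p m q k : ℕ} (hpq : p + m ≤ q) (hq : q + k ≤ n) (D : PPCircuit m)
    (E : PPCircuit k) (X : PPCircuit n) :
    place n p D * (place n q E * X) = place n q E * (place n p D * X) := by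
  rw [← mul_assoc, place_comm hpq hq, mul_assoc]

/-- The new phase slides past the smaller triangle and meets `γ`. If `γ` were nonzero the two would
fuse, so the new phase takes the empty place. -/
theorem isTriangularNormalForm_phase_mul {n : ℕ} {T : PPCircuit n} {α β : ℕ → ℝ} {γ φ : ℝ}
    (hT : IsTriangularNormalForm T) (h : DiagonalAngles α β) (hγ : γ ∈ Set.Ico 0 (2 * π))
    (hC : PPRSIrreducible (place (n + 1) 0 (phase φ) *
      (place (n + 1) 1 T * place (n + 1) 0 (phaseStar γ) * diagonal n α β))) :
    IsTriangularNormalForm (place (n + 1) 0 (phase φ) *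
      (place (n + 1) 1 T * place (n + 1) 0 (phaseStar γ) * diagonal n α β)) := by
  have hφ : φ ∈ Set.Ioo 0 (2 * π) := (hC.left.of_place (by omega)).phase_mem
  rw [mul_assoc, place_comm_assoc (by omega) (by omega), ← mul_assoc (place _ _ (phase φ)),
    ← place_mul] at hC ⊢
  by_cases h₀ : γ = 0
  · rw [h₀, phaseStar_zero, mul_one, ← phaseStar_of_ne hφ.1.ne', ← mul_assoc]
    exact hT.cons h (Set.Ioo_subset_Ico_self hφ)
  · rw [phaseStar_of_ne h₀] at hC
    exact absurd (.phaseFusion γ φ ⟨lt_of_le_of_ne hγ.1 (Ne.symm h₀), hγ.2⟩ hφ)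
      (hC.right.left.of_place (by omega)).not_rule

theorem not_irreducible_euler {n : ℕ} {θ₁ θ₂ γ : ℝ} (hθ₁ : θ₁ ∈ Set.Ioo 0 π)
    (hθ₂ : θ₂ ∈ Set.Ioo 0 π) (hγ : γ ∈ Set.Ico 0 (2 * π)) :
    ¬ PPRSIrreducible (place (n + 2) 0 (bs θ₂) * (place (n + 2) 0 (phaseStar γ) *
      place (n + 2) 0 (bs θ₁))) := by
  intro h
  obtain ⟨o, ho, ho'⟩ := exists_phaseOpt_eq hγ
  obtain ⟨R, hR⟩ := exists_rule_euler hθ₁ hθ₂ ho'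
  refine (PPRSIrreducible.of_place (n := n + 2) (p := 0) (by omega) ?_).not_rule hR
  simp only [comp_eq_mul, wires_eq_one, tensor_one, place_mul]
  rwa [place_place (by omega) (by omega), ← ho]

theorem not_irreducible_slide {n : ℕ} {θ₁ θ₂ θ₃ γ₁ γ₂ : ℝ} (hθ₁ : θ₁ ∈ Set.Ioo 0 π)
    (hθ₂ : θ₂ ∈ Set.Ioo 0 π) (hθ₃ : θ₃ ∈ Set.Ioo 0 π) (hγ₁ : γ₁ ∈ Set.Ico 0 (2 * π))
    (hγ₂ : γ₂ ∈ Set.Ico 0 (2 * π)) :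
    ¬ PPRSIrreducible (place (n + 3) 0 (bs θ₃) * (place (n + 3) 0 (phaseStar γ₂) *
      (place (n + 3) 1 (bs θ₂) * (place (n + 3) 1 (phaseStar γ₁) *
      place (n + 3) 0 (bs θ₁))))) := by
  intro h
  obtain ⟨o₁, ho₁, ho₁'⟩ := exists_phaseOpt_eq hγ₁
  obtain ⟨o₂, ho₂, ho₂'⟩ := exists_phaseOpt_eq hγ₂
  obtain ⟨R, hR⟩ := exists_rule_slide hθ₁ hθ₂ hθ₃ ho₁' ho₂'
  refine (PPRSIrreducible.of_place (n := n + 3) (p := 0) (by omega) ?_).not_rule hR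
  simp only [comp_eq_mul, wires_eq_one, onTop_eq, onBottom_eq, parallel3_eq, place_mul, place_one,
    mul_one]
  rw [place_place (by omega) (by omega), place_place (by omega) (by omega),
    place_place (by omega) (by omega), place_place (by omega) (by omega),
    place_place (by omega) (by omega), ← ho₁, ← ho₂, mul_assoc (place _ _ (phaseStar γ₂)),
    ← place_comm_assoc (p := 0 + 0) (m := 1) (q := 0 + 1) (by omega) (by omega)]
  exact h

theorem topPhase_of_irreducible {θ γ : ℝ} (hθ : θ ∈ Set.Ioo 0 π) (hγ : γ ∈ Set.Ico 0 (2 * π))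
    (h : PPRSIrreducible (bs θ * (phaseStar γ ⊕ₚ (1 : PPCircuit 1)))) :
    γ ∈ Set.Ico 0 π ∧ (θ = π / 2 → γ = 0) := by
  by_cases h₀ : γ = 0
  · exact ⟨⟨hγ.1, h₀ ▸ pi_pos⟩, fun _ => h₀⟩
  rw [phaseStar_of_ne h₀] at h
  have hθ' : θ ≠ π / 2 := by
    rintro rfl
    exact h.not_rule (.topPhaseHalfPi γ ⟨lt_of_le_of_ne hγ.1 (Ne.symm h₀), hγ.2⟩)
  refine ⟨⟨hγ.1, ?_⟩, fun e => absurd e hθ'⟩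
  by_contra! h'
  exact h.not_rule (.topPhasePi γ θ ⟨h', hγ.2⟩ hθ hθ')

/-- The new beam splitter slides past everything on modes `2` and below until it meets the phases
and diagonals on modes `0` and `1`. It survives only when the first diagonal is trivial, and then
prolongs the second diagonal upwards; otherwise an `euler` or `slide` redex appears. -/
theorem isTriangularNormalForm_bs_mul {n : ℕ} {T : PPCircuit n} {α₀ β₀ α₁ β₁ : ℕ → ℝ}
    {γ₀ γ₁ θ : ℝ} (hT : IsTriangularNormalForm T) (h₀ : DiagonalAngles α₀ β₀)
    (h₁ : DiagonalAngles α₁ β₁) (hγ₀ : γ₀ ∈ Set.Ico 0 (2 * π)) (hγ₁ : γ₁ ∈ Set.Ico 0 (2 * π))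
    (hC : PPRSIrreducible (place (n + 2) 0 (bs θ) * (place (n + 2) 1
      (place (n + 1) 1 T * place (n + 1) 0 (phaseStar γ₁) * diagonal n α₁ β₁) *
      place (n + 2) 0 (phaseStar γ₀) * diagonal (n + 1) α₀ β₀))) :
    IsTriangularNormalForm (place (n + 2) 0 (bs θ) * (place (n + 2) 1
      (place (n + 1) 1 T * place (n + 1) 0 (phaseStar γ₁) * diagonal n α₁ β₁) *
      place (n + 2) 0 (phaseStar γ₀) * diagonal (n + 1) α₀ β₀)) := by
  have hθ : θ ∈ Set.Ioo 0 π := (hC.left.of_place (by omega)).bs_mem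
  rw [place_mul, place_mul, place_place (by omega) (by omega), place_place (by omega) (by omega),
    mul_assoc, mul_assoc, mul_assoc,
    place_comm_assoc (p := 0) (m := 2) (q := 1 + 1) (by omega) (by omega)] at hC ⊢
  by_cases hγ : γ₁ = 0
  swap
  · rw [phaseStar_of_ne hγ, ← mul_assoc (place _ _ (bs θ))] at hC
    have hC' : PPRSIrreducible (place (n + 2) 0 (bs θ ∘ₚ (wires 1 ⊕ₚ phase γ₁))) := by
      rw [comp_eq_mul, wires_eq_one, place_mul, place_tensor (by omega), place_one, one_mul]
      exact hC.right.left
    exact absurd (.bottomPhase γ₁ θ ⟨lt_of_le_of_ne hγ₁.1 (Ne.symm hγ), hγ₁.2⟩ hθ)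
      (hC'.of_place (by omega)).not_rule
  rw [hγ, phaseStar_zero, place_one, one_mul,
    ← place_comm_assoc (p := 0) (m := 1) (q := 1) (by omega) (by omega)] at hC ⊢
  by_cases hα₀ : α₀ 0 = 0
  · rw [h₀.diagonal_eq_one hα₀, mul_one] at hC ⊢
    have hC' : PPRSIrreducible (place (n + 2) 0 (bs θ * (phaseStar γ₀ ⊕ₚ (1 : PPCircuit 1)))) := by
      rw [place_mul, place_tensor (by omega), place_one, mul_one]
      rw [← mul_assoc (place _ _ (bs θ))] at hC
      exact hC.right.left
    obtain ⟨hγ', hθγ⟩ := topPhase_of_irreducible hθ hγ₀ (hC'.of_place (by omega))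
    -- The old second diagonal becomes part of the first, with `γ₀` as the phase before the new beam
    -- splitter; mode `1` is left with a trivial diagonal and no phase.
    have := (hT.cons .zero (γ := 0) ⟨le_rfl, two_pi_pos⟩).cons (h₁.cons hθ hγ' hθγ) (γ := 0)
      ⟨le_rfl, two_pi_pos⟩
    rw [diagonal_zero_angles, phaseStar_zero, place_one, place_one, mul_one, mul_one, mul_one,
      place_place (by omega) (by omega), diagonal_succ] at this
    rw [← bsStar_of_ne hθ.1.ne', ← mul_assoc (place _ _ (bsStar θ))]
    exact this
  have hα₀' : α₀ 0 ∈ Set.Ioo 0 π :=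
    ⟨lt_of_le_of_ne (h₀.mem_left 0).1 (Ne.symm hα₀), (h₀.mem_left 0).2⟩
  exfalso
  rw [diagonal_succ, bsStar_of_ne hα₀] at hC
  -- Without the second diagonal, only `γ₀` separates the two top beam splitters.
  have euler_case : diagonal n α₁ β₁ ≠ 1 := by
    intro hd
    rw [hd, place_one, one_mul] at hC
    refine not_irreducible_euler (n := n) hα₀' hθ hγ₀ ?_
    simp only [mul_assoc] at hC ⊢
    have := hC.right
    rw [← mul_assoc, ← mul_assoc] at this
    simpa only [mul_assoc] using this.left
  have hα₁ : α₁ 0 ≠ 0 := fun h => euler_case (h₁.diagonal_eq_one h n)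
  have hα₁' : α₁ 0 ∈ Set.Ioo 0 π :=
    ⟨lt_of_le_of_ne (h₁.mem_left 0).1 (Ne.symm hα₁), (h₁.mem_left 0).2⟩
  cases n with
  | zero => exact euler_case rfl
  | succ n =>
    have hβ : β₁ 0 ∈ Set.Ico 0 (2 * π) :=
      ⟨(h₁.mem_right 0).1, (h₁.mem_right 0).2.trans (by linarith [pi_pos])⟩
    refine not_irreducible_slide (n := n) hα₀' hα₁' hθ hβ hγ₀ ?_
    rw [diagonal_succ n α₁ β₁, bsStar_of_ne hα₁, place_mul, place_mul,
      place_place (by omega) (by omega), place_place (by omega) (by omega),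
      place_place (by omega) (by omega)] at hC
    simp only [mul_assoc] at hC
    have := hC.right
    -- The rest of the second diagonal lies on modes `2` and below; moving it past the top beam
    -- splitter of the first diagonal completes the `slide` pattern.
    rw [← place_comm_assoc (p := 0) (m := 2) (q := 1 + 1) (by omega) (by omega)] at this
    simp only [← mul_assoc] at this ⊢
    exact this.left.left.left

/-- A gate that avoids mode `0` is absorbed by the smaller triangle, by induction on the number of
modes; only the two gates touching mode `0` need an argument. -/
theorem isTriangularNormalForm_gate_mul {n : ℕ} {G T : PPCircuit n} (hG : G ∈ gates n)
    (hT : IsTriangularNormalForm T) (hC : PPRSIrreducible (G * T)) :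
    IsTriangularNormalForm (G * T) := by
  induction n with
  | zero => rcases hG with ⟨p, φ, hp, -⟩ | ⟨p, θ, hp, -⟩ <;> omega
  | succ n ih =>
    obtain ⟨T', α, β, γ, hT', h, hγ, rfl⟩ := hT.exists_eq
    have below : ∀ {G' : PPCircuit n}, G' ∈ gates n → G = place (n + 1) 1 G' →
        IsTriangularNormalForm (G * (place (n + 1) 1 T' * place (n + 1) 0 (phaseStar γ) *
          diagonal n α β)) := by
      rintro G' hG' rfl
      rw [← mul_assoc, ← mul_assoc, ← place_mul] at hC ⊢
      exact (ih hG' hT' (hC.left.left.of_place (by omega))).cons h hγ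
    rcases hG with ⟨p, φ, hp, rfl⟩ | ⟨p, θ, hp, rfl⟩
    · cases p with
      | zero => exact isTriangularNormalForm_phase_mul hT' h hγ hC
      | succ p =>
        exact below (.inl ⟨p, φ, by omega, rfl⟩)
          (by rw [place_place (by omega) (by omega), add_comm p])
    · cases p with
      | zero =>
        obtain ⟨m, rfl⟩ : ∃ m, n = m + 1 := ⟨n - 1, by omega⟩
        obtain ⟨T'', α', β', γ', hT'', h', hγ', rfl⟩ := hT'.exists_eq
        exact isTriangularNormalForm_bs_mul hT'' h h' hγ hγ' hC
      | succ p =>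
        exact below (.inr ⟨p, θ, by omega, rfl⟩)
          (by rw [place_place (by omega) (by omega), add_comm p])

theorem PPRSIrreducible.isTriangularNormalForm {n : ℕ} {C : PPCircuit n}
    (h : PPRSIrreducible C) : IsTriangularNormalForm C := by
  have hC : C ∈ Submonoid.closure (gates n) := closure_gates n ▸ Submonoid.mem_top C
  induction hC using Submonoid.closure_induction_left with
  | one => exact isTriangularNormalForm_one n
  | mul_left G hG T hT ih => exact isTriangularNormalForm_gate_mul hG (ih h.right) h

/-! ### Completeness -/

theorem PPRSStep.reflTransGen_interpH_eq {n : ℕ} {C D : PPCircuit n}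
    (h : Relation.ReflTransGen PPRSStep C D) : C.interpH = D.interpH := by
  induction h with
  | refl => rfl
  | tail _ h ih => exact ih.trans h.interpH_eq

theorem IsPPRSNormalFormOf.isTriangularNormalForm {n : ℕ} {N C : PPCircuit n}
    (h : IsPPRSNormalFormOf N C) : IsTriangularNormalForm N :=
  PPRSIrreducible.isTriangularNormalForm h.2

theorem IsTriangularNormalForm.eq_of_interpH_eq {n : ℕ} {T T' : PPCircuit n}
    (hT : IsTriangularNormalForm T) (hT' : IsTriangularNormalForm T')
    (h : T.interpH = T'.interpH) : T = T' := by
  obtain ⟨α, β, γ, h₁, h₂, rfl⟩ := (isTriangularNormalForm_iff T).1 hT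
  obtain ⟨α', β', γ', h₁', h₂', rfl⟩ := (isTriangularNormalForm_iff T').1 hT'
  exact triangle_unique n h₁ h₁' h₂ h₂' h

/-- Semantics replaces confluence: both normal forms are triangles, and soundness gives them the
same matrix. -/
theorem IsPPRSNormalFormOf.eq_of_interpH_eq {n : ℕ} {N₁ N₂ C₁ C₂ : PPCircuit n}
    (h₁ : IsPPRSNormalFormOf N₁ C₁) (h₂ : IsPPRSNormalFormOf N₂ C₂)
    (h : C₁.interpH = C₂.interpH) : N₁ = N₂ :=
  h₁.isTriangularNormalForm.eq_of_interpH_eq h₂.isTriangularNormalForm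
    ((PPRSStep.reflTransGen_interpH_eq h₁.1).symm.trans
      (h.trans (PPRSStep.reflTransGen_interpH_eq h₂.1)))

theorem existsUnique_isPPRSNormalFormOf {n : ℕ} (C : PPCircuit n) :
    ∃! N, IsPPRSNormalFormOf N C := by
  obtain ⟨N, hN⟩ := exists_isPPRSNormalFormOf C
  exact ⟨N, hN, fun N' hN' => hN'.eq_of_interpH_eq hN rfl⟩

end

theorem mainTheorem6 {n : ℕ} (C₁ C₂ : PPCircuit n) (h : C₁.interpH = C₂.interpH) :
    (∃! N₁ : PPCircuit n, IsPPRSNormalFormOf N₁ C₁) ∧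
    (∃! N₂ : PPCircuit n, IsPPRSNormalFormOf N₂ C₂) ∧
    (∀ N₁ N₂ : PPCircuit n, IsPPRSNormalFormOf N₁ C₁ → IsPPRSNormalFormOf N₂ C₂ →
      IsTriangularNormalForm N₁ ∧ IsTriangularNormalForm N₂ ∧ N₁ = N₂) ∧
    Relation.EqvGen PPRSStep C₁ C₂ := by
  refine ⟨existsUnique_isPPRSNormalFormOf C₁, existsUnique_isPPRSNormalFormOf C₂,
    fun N₁ N₂ h₁ h₂ => ⟨h₁.isTriangularNormalForm, h₂.isTriangularNormalForm,
      h₁.eq_of_interpH_eq h₂ h⟩, ?_⟩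
  obtain ⟨N₁, h₁⟩ := exists_isPPRSNormalFormOf C₁
  obtain ⟨N₂, h₂⟩ := exists_isPPRSNormalFormOf C₂
  obtain rfl := h₁.eq_of_interpH_eq h₂ h
  exact .trans _ _ _ (Relation.EqvGen.reflTransGen_le_eqvGen _ _ _ h₁.1)
    (.symm _ _ (Relation.EqvGen.reflTransGen_le_eqvGen _ _ _ h₂.1))
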